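/- A category with cofibrations is a category with a zero object and a class of morphisms (cofibrations, $\rightarrowtail$) containing every $0\to A$ and every isomorphism, closed under composition, and such that the pushout of a cofibration along any morphism exists and is a cofibration. A cofibration sequence $A\rightarrowtail B\twoheadrightarrow B/A$ is a cofibration followed by its cokernel. A subcategory $\mathcal A$ of $\mathcal C$ is a subcategory with cofibrations if, with cofibrations the morphisms of $\mathcal A$ that are cofibrations of $\mathcal C$ with cokernel in $\mathcal A$, it is a category with cofibrations and the inclusion preserves zero objects, cofibrations and pushouts of cofibrations. For a subcategory $\mathcal D_0\subseteq\mathcal C$ containing a zero object of $\mathcal C$ and all morphisms of $\mathcal C$ between it and the objects of $\mathcal D_0$, let $\langle\mathcal D_0\rangle$ be the intersection of all subcategories with cofibrations of $\mathcal C$ containing $\mathcal D_0$. Let $\mathcal R_f$ be the category of finite based CW complexes (with specified CW structure, the base point being a $0$-cell) and based cellular maps, with cofibrations the cellular inclusions. For a category with cofibrations $\mathcal C$ and a finite linearly ordered set $I$, let $\mathrm{iso}(s_I\mathcal C)$ be the set of isomorphism classes of functors $A$ from the poset $\{(i,j)\in I^2: i\le j\}$ (componentwise order) to $\mathcal C$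 such that $A_{j,j}$ is a zero object for all $j$ and $A_{i,j}\rightarrowtail A_{i,k}\twoheadrightarrow A_{j,k}$ is a cofibration sequence for all $i<j<k$; write $\mathrm{iso}(s_n\mathcal C)$ when $I=\{0<1<\dots<n\}$. For a triangulation $\mathcal T$ of the convex $(n+1)$-gon with vertices labeled cyclically $0,1,\dots,n$, the $2$-Segal map $$f_{\mathcal T}\colon \mathrm{iso}(s_n\mathcal C)\to\lim_{\mathcal T}\mathrm{iso}(s_\bullet\mathcal C)$$ is given by restriction to the vertex sets of the triangles; its target is the set of families, consisting of one class in $\mathrm{iso}(s_\tau\mathcal C)$ for each triangle $\tau\in\mathcal T$, whose members agree on the common edges of the triangles. **Proposition.** There is a subcategory $\mathcal D_0$ of $\mathcal R_f$, containing a zero object of $\mathcal R_f$ and all morphisms of $\mathcal R_f$ between it and the objects of $\mathcal D_0$, such that $\mathcal D=\langle\mathcal D_0\rangle$ is a subcategory with cofibrations of $\mathcal R_f$ (in particular, a category with cofibrations) with the following properties. 1. For every $n\ge 3$ the $2$-Segal map $$\mathrm{iso}(s_n\mathcal D)\to \mathrm{iso}(s_{\{0,1,n\}}\mathcal D)\times_{\mathrm{iso}(s_{\{1,n\}}\mathcal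 D)}\mathrm{iso}(s_{\{1,2,\dots,n\}}\mathcal D)$$ is not surjective. 2. For every $n$ and every triangulation $\mathcal T$ of the $(n+1)$-gon in which some triangle does not contain the vertex $0$, the $2$-Segal map $f_{\mathcal T}$ of $\mathrm{iso}(s_\bullet\mathcal D)$ is not surjective. In particular, the $2$-Segal maps $f_{\mathcal T}$ of $\mathrm{iso}(s_\bullet\mathcal C)$ that are not left $2$-Segal need not be surjective. -/

import Mathlib

open CategoryTheory CategoryTheory.Limits

namespace TwoSegal

universe v u v' u'

/-! ### Categories with cofibrations -/

section Cofibrations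

variable {C : Type u} [Category.{v} C]

/-- A category with cofibrations: a zero object, and a class of morphisms containing all
`0 ⟶ A` and all isomorphisms, closed under composition, such that the pushout of a cofibration
along any morphism exists and is a cofibration. -/
structure IsCategoryWithCofibrations (cof : MorphismProperty C) : Prop where
  exists_zero : ∃ Z : C, IsZero Z
  zero_to : ∀ {Z A : C} (f : Z ⟶ A), IsZero Z → cof f
  of_isIso : ∀ {A B : C} (f : A ⟶ B), IsIso f → cof f
  comp : ∀ {A B D : C} (f : A ⟶ B) (g : B ⟶ D), cof f → cof g → cof (f ≫ g)
  exists_pushout : ∀ {A B A' : C} (i : A ⟶ B) (f : A ⟶ A'), cof i →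
    ∃ (B' : C) (g : B ⟶ B') (i' : A' ⟶ B'), IsPushout i f g i'
  of_isPushout : ∀ {A B A' B' : C} (i : A ⟶ B) (f : A ⟶ A') (g : B ⟶ B') (i' : A' ⟶ B'),
    IsPushout i f g i' → cof i → cof i'

/-- `q : B ⟶ Q` is a cokernel of `i : A ⟶ B`, i.e. the pushout of `i` along `A ⟶ 0`. -/
def IsCokernel {A B Q : C} (i : A ⟶ B) (q : B ⟶ Q) : Prop :=
  ∃ (Z : C) (hZ : IsZero Z), IsPushout i (hZ.from_ A) q (hZ.to_ Q)

/-- A cofibration sequence `A ↣ B ↠ Q`: a cofibration followed by its cokernel. -/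
def IsCofibrationSequence (cof : MorphismProperty C) {A B Q : C} (i : A ⟶ B) (q : B ⟶ Q) : Prop :=
  cof i ∧ IsCokernel i q

/-- Exact functors preserve zero objects, cofibrations and pushouts of cofibrations. -/
structure IsExact {D : Type u'} [Category.{v'} D] (cofC : MorphismProperty C)
    (cofD : MorphismProperty D) (F : C ⥤ D) : Prop where
  map_zero : ∀ Z : C, IsZero Z → IsZero (F.obj Z)
  map_cof : ∀ {A B : C} (f : A ⟶ B), cofC f → cofD (F.map f)
  map_pushout : ∀ {A B A' B' : C} (i : A ⟶ B) (f : A ⟶ A') (g : B ⟶ B') (i' : A' ⟶ B'),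
    IsPushout i f g i' → cofC i → IsPushout (F.map i) (F.map f) (F.map g) (F.map i')

end Cofibrations

/-! ### Subcategories with cofibrations and generation -/

/-- A (not necessarily full) subcategory: a class of objects and a class of morphisms between
them, containing identities and closed under composition. -/
structure Subcategory (C : Type u) [Category.{v} C] where
  obj : C → Prop
  hom : MorphismProperty C
  source_mem : ∀ {X Y : C} (f : X ⟶ Y), hom f → obj X
  target_mem : ∀ {X Y : C} (f : X ⟶ Y), hom f → obj Y
  id_mem : ∀ X : C, obj X → hom (𝟙 X)
  comp_mem : ∀ {X Y Z : C} (f : X ⟶ Y) (g : Y ⟶ Z), hom f → hom g → hom (f ≫ g)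

namespace Subcategory

variable {C : Type u} [Category.{v} C]

/-- The objects of a subcategory. -/
@[ext]
structure Obj (A : Subcategory C) where
  val : C
  property : A.obj val

/-- A subcategory is a category in its own right. -/
instance category (A : Subcategory C) : Category A.Obj where
  Hom X Y := {f : X.val ⟶ Y.val // A.hom f}
  id X := ⟨𝟙 X.val, A.id_mem _ X.property⟩
  comp f g := ⟨f.1 ≫ g.1, A.comp_mem _ _ f.2 g.2⟩

/-- The inclusion functor. -/
def inclusion (A : Subcategory C) : A.Obj ⥤ C where
  obj X := X.val
  map f := f.1

/-- The cofibrations of a subcategory `A` of `C`: the morphisms of `A` that are cofibrations of `C`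
and have a cokernel object (formed in `C`) that is an object of `A`. -/
def cofibrations (cof : MorphismProperty C) (A : Subcategory C) : MorphismProperty A.Obj :=
  fun _ Y f => cof f.1 ∧ ∃ (Q : C) (q : Y.val ⟶ Q), A.obj Q ∧ IsCokernel f.1 q

/-- `A` is a subcategory with cofibrations of `(C, cof)`: with the cofibrations above it is a
category with cofibrations, and the inclusion is exact. -/
structure IsSubcategoryWithCofibrations (cof : MorphismProperty C) (A : Subcategory C) : Prop where
  isCategoryWithCofibrations : IsCategoryWithCofibrations (A.cofibrations cof)
  isExact_inclusion : IsExact (A.cofibrations cof) cof A.inclusion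

/-- Containment of subcategories. -/
structure Contains (A B : Subcategory C) : Prop where
  obj : ∀ X : C, B.obj X → A.obj X
  hom : ∀ {X Y : C} (f : X ⟶ Y), B.hom f → A.hom f

/-- `A` contains a zero object of `C` and all morphisms of `C` between it and objects of `A`. -/
def ContainsZero (A : Subcategory C) : Prop :=
  ∃ Z : C, IsZero Z ∧ A.obj Z ∧
    ∀ X : C, A.obj X → (∀ f : X ⟶ Z, A.hom f) ∧ (∀ f : Z ⟶ X, A.hom f)

/-- The intersection `⟨D₀⟩` of all subcategories with cofibrations of `(C, cof)` containing `D₀`. -/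
def generated (cof : MorphismProperty C) (D₀ : Subcategory C) : Subcategory C where
  obj X := ∀ A : Subcategory C, A.IsSubcategoryWithCofibrations cof → A.Contains D₀ → A.obj X
  hom _ _ f := ∀ A : Subcategory C, A.IsSubcategoryWithCofibrations cof → A.Contains D₀ → A.hom f
  source_mem f hf A hA h := A.source_mem f (hf A hA h)
  target_mem f hf A hA h := A.target_mem f (hf A hA h)
  id_mem X hX A hA h := A.id_mem X (hX A hA h)
  comp_mem f g hf hg A hA h := A.comp_mem f g (hf A hA h) (hg A hA h)

end Subcategory

/-! ### Finite based CW complexes -/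

/-- Finite CW complexes with a specified CW structure and a base point that is a `0`-cell. -/
structure FinBasedCW where
  carrier : Type
  [topologicalSpace : TopologicalSpace carrier]
  [t2Space : T2Space carrier]
  [cwComplex : Topology.CWComplex (Set.univ : Set carrier)]
  [finite : Topology.CWComplex.Finite (Set.univ : Set carrier)]
  base : carrier
  base_mem : base ∈ Topology.CWComplex.skeleton (Set.univ : Set carrier) 0

namespace FinBasedCW

attribute [instance] FinBasedCW.topologicalSpace FinBasedCW.t2Space FinBasedCW.cwComplex
  FinBasedCW.finite

/-- Based cellular maps: continuous maps preserving the base point and all skeleta. -/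
@[ext]
structure Hom (X Y : FinBasedCW) where
  toMap : C(X.carrier, Y.carrier)
  map_base : toMap X.base = Y.base
  cellular : ∀ n : ℕ, Set.MapsTo toMap
    (Topology.CWComplex.skeleton (Set.univ : Set X.carrier) n)
    (Topology.CWComplex.skeleton (Set.univ : Set Y.carrier) n)

/-- The category of finite based CW complexes and based cellular maps. -/
instance category : Category FinBasedCW where
  Hom := Hom
  id X := ⟨ContinuousMap.id _, rfl, fun _ _ hx => hx⟩
  comp f g := ⟨g.toMap.comp f.toMap, by
    rw [ContinuousMap.comp_apply, f.map_base, g.map_base],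
    fun n _ hx => g.cellular n (f.cellular n hx)⟩

/-- Cellular inclusions: topological embeddings carrying each open cell onto an open cell of the
same dimension, i.e. isomorphisms onto a subcomplex followed by its inclusion. -/
def cellularInclusion : MorphismProperty FinBasedCW := fun X Y f =>
  Topology.IsEmbedding (Hom.toMap f) ∧
    ∀ (n : ℕ) (i : Topology.RelCWComplex.cell (Set.univ : Set X.carrier) n),
      ∃ j : Topology.RelCWComplex.cell (Set.univ : Set Y.carrier) n,
        Hom.toMap f '' Topology.RelCWComplex.openCell n i = Topology.RelCWComplex.openCell n j

end FinBasedCW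

/-! ### Isomorphism classes of the `S`-construction -/

/-- The arrow category of a poset `I`: the poset of pairs `i ≤ j`, ordered componentwise. -/
abbrev Ar (I : Type) [PartialOrder I] : Type := {p : I × I // p.1 ≤ p.2}

namespace Ar

/-- The object `(i, j)`. -/
abbrev mk {I : Type} [PartialOrder I] {i j : I} (h : i ≤ j) : Ar I := ⟨(i, j), h⟩

/-- The functor on arrow categories induced by an order embedding. -/
def map {I J : Type} [PartialOrder I] [PartialOrder J] (f : I ↪o J) : Ar I ⥤ Ar J :=
  Monotone.functor (f := fun p : Ar I => (⟨(f p.1.1, f p.1.2), f.monotone p.2⟩ : Ar J))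
    (fun _ _ h => ⟨f.monotone h.1, f.monotone h.2⟩)

end Ar

section SConstruction

variable {C : Type u} [Category.{v} C] (cof : MorphismProperty C)

/-- The objects of `S_I C`: functors `A` on the arrow category of `I` with `A_{j,j}` a zero object
and `A_{i,j} ↣ A_{i,k} ↠ A_{j,k}` a cofibration sequence for all `i < j < k`. -/
structure IsSObject (I : Type) [LinearOrder I] (A : Ar I ⥤ C) : Prop where
  isZero : ∀ j : I, IsZero (A.obj (Ar.mk (le_refl j)))
  sequence : ∀ {i j k : I} (hij : i < j) (hjk : j < k),
    IsCofibrationSequence cof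
      (A.map (homOfLE (show Ar.mk hij.le ≤ Ar.mk (hij.trans hjk).le from ⟨le_rfl, hjk.le⟩)))
      (A.map (homOfLE (show Ar.mk (hij.trans hjk).le ≤ Ar.mk hjk.le from ⟨hij.le, le_rfl⟩)))

/-- The category `S_I C`, a full subcategory of the functor category; `S_n C` is the case
`I = Fin (n + 1)`. -/
abbrev SCat (I : Type) [LinearOrder I] :=
  (show ObjectProperty (Ar I ⥤ C) from IsSObject cof I).FullSubcategory

/-- Restriction `S_J C ⥤ S_I C` along an order embedding `I ↪o J`, by precomposition. -/
def SCat.restrict {I J : Type} [LinearOrder I] [LinearOrder J] (f : I ↪o J) :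
    SCat cof J ⥤ SCat cof I :=
  ObjectProperty.lift _ (ObjectProperty.ι _ ⋙ (Functor.whiskeringLeft _ _ C).obj (Ar.map f))
    (fun A => ⟨fun j => A.property.isZero (f j),
      fun hij hjk => A.property.sequence (f.strictMono hij) (f.strictMono hjk)⟩)

/-- `iso(s_I C)`: the set of isomorphism classes of objects of `S_I C`. -/
abbrev IsoS (I : Type) [LinearOrder I] := Quotient (isIsomorphicSetoid (SCat cof I))

/-- Restriction of isomorphism classes along an order embedding. -/
def IsoS.restrict {I J : Type} [LinearOrder I] [LinearOrder J] (f : I ↪o J) :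
    IsoS cof J → IsoS cof I :=
  Quotient.map (SCat.restrict cof f).obj fun _ _ ⟨e⟩ => ⟨(SCat.restrict cof f).mapIso e⟩

theorem IsoS.restrict_restrict {I J K : Type} [LinearOrder I] [LinearOrder J] [LinearOrder K]
    (f : I ↪o J) (g : J ↪o K) (h : I ↪o K) (hfg : ∀ i, h i = g (f i)) (x : IsoS cof K) :
    IsoS.restrict cof f (IsoS.restrict cof g x) = IsoS.restrict cof h x := by
  obtain rfl : h = f.trans g := by ext i; exact hfg i
  induction x using Quotient.inductionOn with
  | h A => rfl

end SConstruction

/-! ### Triangulations and 2-Segal maps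

The vertices of the `(n + 1)`-gon `P_n` are `0, 1, …, n` in cyclic order, and a polygon with
vertices among these is given by its set of vertices. -/

/-- Some chord between vertices of `p` and some chord between vertices of `q` cross in the interior
of the polygon; `a < c < b < d` are the ends `a, b ∈ p` and `c, d ∈ q`, or the other way round. -/
def Crossing {n : ℕ} (p q : Finset (Fin (n + 1))) : Prop :=
  (∃ a ∈ p, ∃ c ∈ q, ∃ b ∈ p, ∃ d ∈ q, a < c ∧ c < b ∧ b < d) ∨
    (∃ a ∈ q, ∃ c ∈ p, ∃ b ∈ q, ∃ d ∈ p, a < c ∧ c < b ∧ b < d)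

/-- Triangulations of `P_n`, as sets of triangles: the triangles do not cross each other (so that
distinct ones have disjoint interiors), and no further triangle can be added (so that they cover
`P_n`). -/
structure IsTriangulation (n : ℕ) (T : Finset (Finset (Fin (n + 1)))) : Prop where
  card_eq_three : ∀ τ ∈ T, τ.card = 3
  not_crossing : ∀ τ ∈ T, ∀ σ ∈ T, ¬ Crossing τ σ
  maximal : ∀ σ : Finset (Fin (n + 1)), σ.card = 3 → (∀ τ ∈ T, ¬ Crossing τ σ) → σ ∈ T

/-- The inclusion of sets of vertices as an order embedding. -/
abbrev incl {n : ℕ} {p q : Finset (Fin (n + 1))} (h : p ⊆ q) : {x // x ∈ p} ↪o {x // x ∈ q} :=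
  Subtype.orderEmbedding fun _ hx => h hx

section SegalMap

variable {C : Type u} [Category.{v} C] (cof : MorphismProperty C)

/-- The limit of `iso(s_• C)` over the members of a polygonal subdivision and their common edges:
families of classes, one in `iso(s_p C)` for each member `p`, that agree on common edges. -/
def SegalLimit {n : ℕ} (T : Finset (Finset (Fin (n + 1)))) :=
  {x : ∀ p : {p // p ∈ T}, IsoS cof {v // v ∈ p.1} //
    ∀ p q : {p // p ∈ T}, (p.1 ∩ q.1).card = 2 →
      IsoS.restrict cof (incl (Finset.inter_subset_left (s₁ := p.1) (s₂ := q.1))) (x p) =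
        IsoS.restrict cof (incl (Finset.inter_subset_right (s₁ := p.1) (s₂ := q.1))) (x q)}

/-- The 2-Segal map of `iso(s_• C)` associated with a polygonal subdivision of `P_n`. -/
def segalMap {n : ℕ} (T : Finset (Finset (Fin (n + 1)))) :
    IsoS cof (Fin (n + 1)) → SegalLimit cof T := fun x =>
  ⟨fun p => IsoS.restrict cof (OrderEmbedding.subtype (· ∈ p.1)) x, fun p q _ => by
    rw [IsoS.restrict_restrict cof _ _ (OrderEmbedding.subtype (· ∈ p.1 ∩ q.1)) (fun _ => rfl),
      IsoS.restrict_restrict cof _ _ (OrderEmbedding.subtype (· ∈ p.1 ∩ q.1)) (fun _ => rfl)]⟩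

end SegalMap

end TwoSegal

/-!
The subcategory `D` consists of finite discrete complexes, that is, of finite based sets, equipped
with an additional structure that prevents cofibration sequences from splitting. The structure is a
based map `X → X ∧ X`, and the morphisms are the based maps compatible with it (`SmashCoalg`). As in
every category of coalgebras, colimits are formed on underlying based sets; hence the injections
are the cofibrations of a category with cofibrations, and the functor to complexes is exact.

The 2-Segal maps fail to be surjective because of the coalgebra `linkedPair`. It has elements
`a, x, y` besides the base point, with `x ↦ (y, a)` and `y ↦ (x, a)`, so that a subobject that
contains `x` contains `y` as well. In the quotient by `{a}` the pairs `(y, a)` and `(x, a)` become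
trivial, so that this quotient, `freePair`, has `{x}` as a subobject. For vertices `h < i < j < k`,
a functor with `A_{h,i} ↣ A_{h,k} ↠ A_{i,k}` given by `{a} ↣ {a, x, y} ↠ {x, y}` and
`A_{i,j} ↣ A_{i,k} ↠ A_{j,k}` given by `{x} ↣ {x, y} ↠ {y}` would contain the preimage `{a, x}` of
`{x}` as `A_{h,j}`; but there is no such subobject (`SmashCoalg.false_of_isLinked`). On the other
hand, the two cofibration sequences come from filtered coalgebras, which restrict to all sets of
vertices on either side of the chord from `i` to `k`. So there is a compatible family without
preimage whenever a subdivision has members containing `h, i, k` and `i, j, k` on the two sides of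
this chord (`SmashCoalg.subcategory.not_surjective_segalMap`). In a triangulation in which some
triangle does not contain `0` there are such triangles with `h = 0`
(`IsTriangulation.exists_adjacent`).

To realize coalgebras by a subcategory of the category of complexes, the structure has to be
recoverable from the complex. A CW structure on a discrete space includes the names of the
`0`-cells, that is, a bijection of the space with its set of `0`-cells. Replacing each element by
three copies gives enough such bijections to record the structure
(`SmashCoalg.nonempty_embedding_perm`), and tripling the elements is compatible with pushouts. The
resulting subcategory is equivalent to the category of coalgebras, it is a subcategory with
cofibrations, and therefore it is generated by itself: both `D₀` and `D` are this subcategory.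
-/

namespace TwoSegal

/-! ### Discrete complexes -/

/-- A criterion for pushouts without chosen descent maps. -/
theorem isPushout_of_desc {C : Type*} [Category C] {A B A' P : C} {i : A ⟶ B} {f : A ⟶ A'}
    {g : B ⟶ P} {i' : A' ⟶ P} (w : i ≫ g = f ≫ i')
    (desc : ∀ {W : C} (k : B ⟶ W) (h : A' ⟶ W), i ≫ k = f ≫ h →
      ∃ l : P ⟶ W, g ≫ l = k ∧ i' ≫ l = h)
    (ext : ∀ {W : C} (l l' : P ⟶ W), g ≫ l = g ≫ l' → i' ≫ l = i' ≫ l' → l = l') :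
    IsPushout i f g i' where
  w := w
  isColimit' := ⟨PushoutCocone.IsColimit.mk _ (fun s => (desc s.inl s.inr s.condition).choose)
    (fun s => (desc s.inl s.inr s.condition).choose_spec.1)
    (fun s => (desc s.inl s.inr s.condition).choose_spec.2)
    (fun s _ h₁ h₂ => ext _ _
      (h₁.trans (desc s.inl s.inr s.condition).choose_spec.1.symm)
      (h₂.trans (desc s.inl s.inr s.condition).choose_spec.2.symm))⟩

namespace FinBasedCW

open Topology

/-- A complex without cells of positive dimension. -/
def ZeroDim (X : FinBasedCW) : Prop :=
  ∀ n, IsEmpty (RelCWComplex.cell (Set.univ : Set X.carrier) (n + 1))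

namespace ZeroDim

variable {X Y : FinBasedCW}

theorem exists_cell (hX : X.ZeroDim) (x : X.carrier) :
    ∃ c : RelCWComplex.cell (Set.univ : Set X.carrier) 0, RelCWComplex.openCell 0 c = {x} := by
  have h := Set.mem_univ x
  rw [← CWComplex.iUnion_openCell_eq_complex (C := (Set.univ : Set X.carrier))] at h
  simp only [Set.mem_iUnion] at h
  obtain ⟨n, c, hc⟩ := h
  cases n with
  | succ n => exact ((hX n).false c).elim
  | zero =>
    refine ⟨c, ?_⟩
    rw [RelCWComplex.openCell_zero_eq_singleton] at hc ⊢
    rw [Set.mem_singleton_iff.1 hc]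

theorem skeleton_eq (hX : X.ZeroDim) (n : ℕ) :
    (CWComplex.skeleton (Set.univ : Set X.carrier) n : Set X.carrier) = Set.univ := by
  refine Set.eq_univ_of_forall fun x => ?_
  obtain ⟨c, hc⟩ := hX.exists_cell x
  have h0 : x ∈ CWComplex.skeleton (Set.univ : Set X.carrier) (0 : ℕ) :=
    CWComplex.openCell_subset_skeleton 0 c (by rw [hc]; rfl)
  exact CWComplex.skeleton_mono (by exact_mod_cast Nat.zero_le n) h0

theorem finite (hX : X.ZeroDim) : Finite X.carrier := by
  have : Finite (RelCWComplex.cell (Set.univ : Set X.carrier) 0) :=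
    CWComplex.FiniteType.finite_cell (C := (Set.univ : Set X.carrier)) 0
  choose c hc using hX.exists_cell
  exact Finite.of_injective c fun x y h => Set.singleton_injective (by rw [← hc, ← hc, h])

theorem discreteTopology (hX : X.ZeroDim) : DiscreteTopology X.carrier :=
  have := hX.finite
  inferInstance

/-- Out of a complex of dimension zero, every based map into the zero skeleton is continuous and
cellular. -/
def homMk (hX : X.ZeroDim) (f : X.carrier → Y.carrier) (hf : f X.base = Y.base)
    (hs : ∀ x, f x ∈ CWComplex.skeleton (Set.univ : Set Y.carrier) 0) : X ⟶ Y :=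
  ({ toMap := ⟨f, have := hX.discreteTopology; continuous_of_discreteTopology⟩
     map_base := hf
     cellular := fun n x _ => CWComplex.skeleton_mono (by exact_mod_cast Nat.zero_le n) (hs x) } :
    Hom X Y)

theorem mem_skeleton (hX : X.ZeroDim) (x : X.carrier) :
    x ∈ CWComplex.skeleton (Set.univ : Set X.carrier) 0 := by
  have h : x ∈ (CWComplex.skeleton (Set.univ : Set X.carrier) (0 : ℕ) : Set X.carrier) := by
    rw [hX.skeleton_eq]
    trivial
  simp only [Nat.cast_zero] at h
  exact h

theorem map_mem (hX : X.ZeroDim) (f : X ⟶ Y) (x : X.carrier) :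
    Hom.toMap f x ∈ CWComplex.skeleton (Set.univ : Set Y.carrier) 0 := by
  have h := Hom.cellular f 0 (x := x)
  simp only [Nat.cast_zero] at h
  exact h (hX.mem_skeleton x)

/-- Between complexes of dimension zero, the cellular inclusions are the injections. -/
theorem cellularInclusion_iff (hX : X.ZeroDim) (hY : Y.ZeroDim) (f : X ⟶ Y) :
    cellularInclusion f ↔ Function.Injective (Hom.toMap f) := by
  have := hX.discreteTopology
  have := hY.discreteTopology
  refine ⟨fun h => h.1.injective, fun h => ⟨?_, fun n c => ?_⟩⟩
  · exact (IsClosedEmbedding.of_continuous_injective_isClosedMap (Hom.toMap f).continuous h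
      fun _ _ => isClosed_discrete _).isEmbedding
  · cases n with
    | succ n => exact ((hX n).false c).elim
    | zero =>
      rw [RelCWComplex.openCell_zero_eq_singleton, Set.image_singleton]
      obtain ⟨d, hd⟩ := hY.exists_cell (Hom.toMap f (RelCWComplex.map 0 c ![]))
      exact ⟨d, hd.symm⟩

end ZeroDim

@[ext]
theorem hom_ext {X Y : FinBasedCW} {f g : X ⟶ Y} (h : ∀ x, Hom.toMap f x = Hom.toMap g x) : f = g :=
  Hom.ext (ContinuousMap.ext h)

/-- The CW structure on a finite discrete space whose `0`-cells are named through the permutation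
`π`: the cell with name `s` is the point `π s`. -/
noncomputable abbrev discreteCWComplex (S : Type) [TopologicalSpace S] [DiscreteTopology S]
    [Finite S] (π : Equiv.Perm S) : CWComplex (Set.univ : Set S) where
  cell n := Nat.casesOn n S fun _ => PEmpty
  map n := Nat.casesOn n
    (fun s => PartialEquiv.single (0 : Fin 0 → ℝ) (π s))
    (fun _ s => s.elim)
  source_eq n i := by
    cases n with
    | succ n => exact i.elim
    | zero => ext x; simp [Subsingleton.elim x 0]
  continuousOn n i := by
    cases n with
    | succ n => exact i.elim
    | zero => exact continuousOn_const
  continuousOn_symm n i := by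
    cases n with
    | succ n => exact i.elim
    | zero => exact continuousOn_const
  pairwiseDisjoint' := by
    rintro ⟨n, s⟩ - ⟨m, t⟩ - hst
    cases n with
    | succ n => exact s.elim
    | zero =>
      cases m with
      | succ m => exact t.elim
      | zero =>
        refine Set.disjoint_left.2 ?_
        rintro _ ⟨x, -, rfl⟩ ⟨y, -, h⟩
        refine hst ?_
        have : s = t := π.injective h.symm
        rw [this]
  mapsTo' n i := by
    cases n with
    | succ n => exact i.elim
    | zero =>
      refine ⟨fun _ => ∅, fun x hx => ?_⟩
      rw [Metric.mem_sphere, Subsingleton.elim x 0, dist_self] at hx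
      exact absurd hx zero_ne_one
  closed' _ _ _ := isClosed_discrete _
  union' := by
    refine Set.eq_univ_of_forall fun s => ?_
    simp only [Set.mem_iUnion]
    exact ⟨0, π.symm s, 0, by simp, π.apply_symm_apply s⟩

/-- The finite based CW complex with underlying discrete space `S`, whose cells are named
through `π`. -/
noncomputable def discrete (S : Type) [Finite S] (base : S) (π : Equiv.Perm S) : FinBasedCW :=
  letI : TopologicalSpace S := ⊥
  haveI : DiscreteTopology S := ⟨rfl⟩
  letI := discreteCWComplex S π
  { carrier := S
    base := base
    finite := by
      refine @CWComplex.finite_of_finite_cells _ _ _ _ _ ?_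
      have : Function.Surjective
        (fun s : S => (⟨0, s⟩ : Σ n, RelCWComplex.cell (Set.univ : Set S) n)) := by
        rintro ⟨n, s⟩
        cases n with
        | succ n => exact PEmpty.elim s
        | zero => exact ⟨s, rfl⟩
      exact Finite.of_surjective _ this
    base_mem := CWComplex.openCell_subset_skeleton (C := (Set.univ : Set S)) 0 (π.symm base)
      ⟨0, by simp, π.apply_symm_apply base⟩ }

variable {S : Type} [Finite S] {base : S} {π : Equiv.Perm S}

theorem zeroDim_discrete : (discrete S base π).ZeroDim := fun _ =>
  inferInstanceAs (IsEmpty PEmpty)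

/-- The naming of the cells is part of the complex. -/
theorem perm_eq_of_discrete_eq {π' : Equiv.Perm S} (h : discrete S base π = discrete S base π') :
    π = π' := by
  have key : ∀ X : FinBasedCW, X = discrete S base π → ∀ (h₁ : S = X.carrier)
      (h₂ : S = RelCWComplex.cell (Set.univ : Set X.carrier) 0) (s : S),
      RelCWComplex.map 0 (cast h₂ s) 0 = cast h₁ (π s) := by
    rintro X rfl h₁ h₂ s
    rfl
  ext s
  exact (key _ h.symm rfl rfl s).symm

end FinBasedCW

/-! ### Based sets with a map to their smash square -/

/-- The map of pairs induced by a partial map `f`, undefined as soon as `f` is undefined at one of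
the entries: this is `f ∧ f` if partial maps are viewed as based maps. -/
def smash {α β : Type} (f : α → Option β) (p : α × α) : Option (β × β) :=
  (f p.1).bind fun a => (f p.2).map fun b => (a, b)

theorem smash_eq_some {α β : Type} {f : α → Option β} {p : α × α} {q : β × β} :
    smash f p = some q ↔ f p.1 = some q.1 ∧ f p.2 = some q.2 := by
  obtain ⟨q₁, q₂⟩ := q
  simp [smash, Option.bind_eq_some_iff, Option.map_eq_some_iff]

theorem smash_bind {α β γ : Type} (f : α → Option β) (g : β → Option γ) (p : α × α) :
    smash (fun x => (f x).bind g) p = (smash f p).bind (smash g) := by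
  simp only [smash]
  cases f p.1 <;> cases f p.2 <;> simp [smash]

/-- A finite based set together with a based map to its smash square. The elements of `carrier`
are those different from the base point, and the value `none` stands for the base point. -/
structure SmashCoalg where
  carrier : Type
  [finite : Finite carrier]
  op : carrier → Option (carrier × carrier)

namespace SmashCoalg

attribute [instance] SmashCoalg.finite

/-- Based maps compatible with the maps to the smash squares. They are encoded as partial maps; an
element is sent to the base point where `toFun` takes the value `none`. -/
@[ext]
structure Hom (X Y : SmashCoalg) where
  toFun : X.carrier → Option Y.carrier
  comm : ∀ x, (toFun x).bind Y.op = (X.op x).bind (smash toFun)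

instance category : Category SmashCoalg where
  Hom := Hom
  id X := ⟨some, fun x => by simp [show smash (some : X.carrier → _) = some from rfl]⟩
  comp f g := ⟨fun x => (f.toFun x).bind g.toFun, fun x => by
    simp only [Option.bind_assoc, g.comm, smash_bind]
    rw [← Option.bind_assoc, f.comm, Option.bind_assoc]⟩
  id_comp _ := Hom.ext (funext fun _ => rfl)
  comp_id f := Hom.ext (funext fun x => show (f.toFun x).bind some = f.toFun x by simp)
  assoc _ _ _ := Hom.ext (funext fun _ => Option.bind_assoc _ _ _)

variable {X Y Z : SmashCoalg}

@[ext]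
theorem hom_ext {f g : X ⟶ Y} (h : ∀ x, Hom.toFun f x = Hom.toFun g x) : f = g :=
  Hom.ext (funext h)

theorem congr_toFun {f g : X ⟶ Y} (h : f = g) (x : X.carrier) : Hom.toFun f x = Hom.toFun g x := by
  rw [h]

@[simp]
theorem toFun_comp (f : X ⟶ Y) (g : Y ⟶ Z) (x : X.carrier) :
    Hom.toFun (f ≫ g) x = (Hom.toFun f x).bind (Hom.toFun g) := rfl

/-- The map sending everything to the base point. -/
def trivialHom (X Y : SmashCoalg) : X ⟶ Y :=
  (⟨fun _ => none, fun x => by cases X.op x <;> simp [smash]⟩ : Hom X Y)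

theorem isZero_iff : IsZero X ↔ IsEmpty X.carrier := by
  refine ⟨fun h => ⟨fun x => ?_⟩, fun h => ⟨fun Y => ?_, fun Y => ?_⟩⟩
  · have := congrArg (fun f => Hom.toFun f x) (h.eq_of_src (𝟙 X) (trivialHom X X))
    simp [trivialHom] at this
  · exact ⟨⟨⟨trivialHom X Y⟩, fun f => hom_ext fun x => h.elim x⟩⟩
  · refine ⟨⟨⟨trivialHom Y X⟩, fun f => hom_ext fun x => ?_⟩⟩
    cases hx : Hom.toFun f x with
    | none => rfl
    | some y => exact h.elim y

/-- The isomorphism underlying a bijection compatible with the operations. -/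
def isoOfEquiv (e : X.carrier ≃ Y.carrier)
    (he : ∀ x, Y.op (e x) = (X.op x).map (Prod.map e e)) : X ≅ Y where
  hom := (⟨fun x => some (e x), fun x => by
    cases h : X.op x <;> simp [he, h, smash, Prod.map]⟩ : Hom X Y)
  inv := (⟨fun y => some (e.symm y), fun y => by
    obtain ⟨x, rfl⟩ := e.surjective y
    cases h : X.op x <;> simp [he, h, smash]⟩ : Hom Y X)
  hom_inv_id := hom_ext fun x => congrArg some (e.symm_apply_apply x)
  inv_hom_id := hom_ext fun y => congrArg some (e.apply_symm_apply y)

/-- Morphisms that are injective as maps of based sets. -/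
def injective : MorphismProperty SmashCoalg := fun X Y f =>
  ∃ j : X.carrier → Y.carrier, Function.Injective j ∧ ∀ x, Hom.toFun f x = some (j x)

theorem injective_of_isIso (f : X ⟶ Y) [IsIso f] : injective f := by
  have h : ∀ x, ∃ y, Hom.toFun f x = some y ∧ Hom.toFun (inv f) y = some x := by
    intro x
    have : Hom.toFun (f ≫ inv f) x = some x := by rw [IsIso.hom_inv_id]; rfl
    exact Option.bind_eq_some_iff.1 this
  choose j h₁ h₂ using h
  refine ⟨j, fun x x' e => ?_, h₁⟩
  have := (h₂ x).symm.trans ((congrArg _ e).trans (h₂ x'))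
  exact Option.some_injective _ this

theorem injective_comp (f : X ⟶ Y) (g : Y ⟶ Z) (hf : injective f) (hg : injective g) :
    injective (f ≫ g) := by
  obtain ⟨j, hj, hf⟩ := hf
  obtain ⟨k, hk, hg⟩ := hg
  exact ⟨k ∘ j, hk.comp hj, fun x => by simp [hf, hg]⟩

theorem injective_of_isZero (f : X ⟶ Y) (hX : IsZero X) : injective f :=
  have := isZero_iff.1 hX
  ⟨fun x => isEmptyElim x, fun x => isEmptyElim x, fun x => isEmptyElim x⟩

section Pushout

variable {A B A' : SmashCoalg} (i : A ⟶ B) (f : A ⟶ A')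

/-- The elements of `B` outside the image of `i`. -/
abbrev Compl : Type := {b : B.carrier // ∀ a, Hom.toFun i a ≠ some b}

open Classical in
/-- The map from `B` to the pushout of an injection `i` along `f`, on elements. -/
noncomputable def pushoutMap (b : B.carrier) : Option (A'.carrier ⊕ Compl i) :=
  if h : ∃ a, Hom.toFun i a = some b then (Hom.toFun f h.choose).map Sum.inl
  else some (Sum.inr ⟨b, not_exists.1 h⟩)

theorem pushoutMap_compl (b : Compl i) : pushoutMap i f b.1 = some (Sum.inr b) :=
  dif_neg (not_exists.2 b.2)

theorem pushoutMap_of_injective (hi : injective i) {a : A.carrier} {b : B.carrier}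
    (h : Hom.toFun i a = some b) : pushoutMap i f b = (Hom.toFun f a).map Sum.inl := by
  have h' : ∃ a, Hom.toFun i a = some b := ⟨a, h⟩
  obtain ⟨j, hj, hi⟩ := hi
  have : h'.choose = a := hj <| Option.some_injective _ <| by
    rw [← hi, ← hi, h'.choose_spec, h]
  rw [pushoutMap, dif_pos h', this]

/-- The pushout of an injection `i` along `f`. Its underlying based set is the pushout of the
underlying based sets. -/
noncomputable abbrev pushoutObj : SmashCoalg where
  carrier := A'.carrier ⊕ Compl i
  op := Sum.elim (fun a' => (A'.op a').map (Prod.map Sum.inl Sum.inl))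
    fun b => (B.op b.1).bind (smash (pushoutMap i f))

/-- The map `A' ⟶ A' ⊔_A B`. -/
noncomputable def pushoutInr : A' ⟶ pushoutObj i f :=
  (⟨fun a' => some (Sum.inl a'), fun a' => by
    cases h : A'.op a' <;> simp [pushoutObj, h, smash, Prod.map]⟩ : Hom A' (pushoutObj i f))

theorem injective_pushoutInr : injective (pushoutInr i f) :=
  ⟨Sum.inl, Sum.inl_injective, fun _ => rfl⟩

variable {i} (hi : injective i)

/-- The map `B ⟶ A' ⊔_A B`. -/
noncomputable def pushoutInl : B ⟶ pushoutObj i f :=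
  (⟨pushoutMap i f, fun b => by
    by_cases h : ∃ a, Hom.toFun i a = some b
    · obtain ⟨a, ha⟩ := h
      have hb : B.op b = (A.op a).bind (smash (Hom.toFun i)) := by
        rw [← Hom.comm i, ha, Option.bind_some]
      have hf := Hom.comm f a
      rw [pushoutMap_of_injective i f hi ha, hb, Option.bind_assoc]
      have h₁ : ∀ x, (Hom.toFun i x).bind (pushoutMap i f) =
          (Hom.toFun f x).bind fun y => some (Sum.inl y) := by
        intro x
        obtain ⟨j, -, hj⟩ := id hi
        rw [hj, Option.bind_some, pushoutMap_of_injective i f hi (hj x), Option.map_eq_bind]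
        rfl
      have h₂ : ((Hom.toFun f a).map Sum.inl).bind (pushoutObj i f).op =
          ((Hom.toFun f a).bind A'.op).map (Prod.map Sum.inl Sum.inl) := by
        cases Hom.toFun f a <;> rfl
      refine h₂.trans ?_
      rw [hf]
      simp_rw [← smash_bind, h₁, smash_bind]
      rw [← Option.bind_assoc]
      cases (A.op a).bind (smash (Hom.toFun f)) <;> rfl
    · have := pushoutMap_compl i f ⟨b, not_exists.1 h⟩
      simp only at this
      rw [this]
      rfl⟩ : Hom B (pushoutObj i f))

theorem toFun_pushoutInl {b : B.carrier} :
    Hom.toFun (pushoutInl f hi) b = pushoutMap i f b := rfl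

theorem pushout_condition : i ≫ pushoutInl f hi = f ≫ pushoutInr i f := by
  ext1 a
  obtain ⟨j, -, hj⟩ := id hi
  rw [toFun_comp, toFun_comp, hj, Option.bind_some, toFun_pushoutInl,
    pushoutMap_of_injective i f hi (hj a), Option.map_eq_bind]
  rfl

theorem isPushout_pushoutObj :
    IsPushout i f (pushoutInl f hi) (pushoutInr i f) := by
  refine isPushout_of_desc (pushout_condition f hi) (fun {W} k h w => ?_) fun {W} l l' h₁ h₂ => ?_
  · have w' : ∀ a, (Hom.toFun i a).bind (Hom.toFun k) = (Hom.toFun f a).bind (Hom.toFun h) :=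
      fun a => congrArg (fun g => Hom.toFun g a) w
    let l : A'.carrier ⊕ Compl i → Option W.carrier :=
      Sum.elim (Hom.toFun h) fun b => Hom.toFun k b.1
    have hl : ∀ b, (pushoutMap i f b).bind l = Hom.toFun k b := by
      intro b
      by_cases hb : ∃ a, Hom.toFun i a = some b
      · obtain ⟨a, ha⟩ := hb
        have := w' a
        rw [ha, Option.bind_some] at this
        rw [pushoutMap_of_injective i f hi ha, this]
        cases Hom.toFun f a <;> rfl
      · have := pushoutMap_compl i f ⟨b, not_exists.1 hb⟩
        simp only at this
        rw [this]
        rfl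
    have comm : ∀ p, (l p).bind W.op = ((pushoutObj i f).op p).bind (smash l) := by
      rintro (a' | b)
      · have h₂ : ((pushoutObj i f).op (Sum.inl a')).bind (smash l) =
            (A'.op a').bind (smash (Hom.toFun h)) := by
          change ((A'.op a').map _).bind _ = _
          cases A'.op a' <;> rfl
        rw [h₂]
        exact Hom.comm h a'
      · refine (Hom.comm k b.1).trans ?_
        change _ = ((B.op b.1).bind (smash (pushoutMap i f))).bind (smash l)
        rw [Option.bind_assoc]
        simp_rw [← smash_bind, hl]
    exact ⟨(⟨l, comm⟩ : Hom (pushoutObj i f) W), hom_ext hl, hom_ext fun a' => rfl⟩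
  · ext1 p
    rcases p with a' | b
    · exact congrArg (fun g => Hom.toFun g a') h₂
    · have := congrArg (fun g => Hom.toFun g b.1) h₁
      simpa [toFun_pushoutInl, pushoutMap_compl] using this

/-- Every pushout square of an injection is isomorphic to the explicit one. -/
theorem _root_.CategoryTheory.IsPushout.exists_iso_pushoutObj
    {P : SmashCoalg} {g : B ⟶ P} {i' : A' ⟶ P}
    (h : IsPushout i f g i') : ∃ e : pushoutObj i f ≅ P,
      pushoutInl f hi ≫ e.hom = g ∧ pushoutInr i f ≫ e.hom = i' :=
  ⟨(isPushout_pushoutObj f hi).isoIsPushout _ _ h, by simp, by simp⟩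

end Pushout

theorem isCategoryWithCofibrations_injective : IsCategoryWithCofibrations injective where
  exists_zero := ⟨⟨PEmpty, fun x => x.elim⟩, isZero_iff.2 (inferInstanceAs (IsEmpty PEmpty))⟩
  zero_to := injective_of_isZero
  of_isIso f _ := injective_of_isIso f
  comp := injective_comp
  exists_pushout i f hi := ⟨_, _, _, isPushout_pushoutObj f hi⟩
  of_isPushout i f g i' h hi := by
    obtain ⟨e, -, rfl⟩ := h.exists_iso_pushoutObj f hi
    exact injective_comp _ _ (injective_pushoutInr i f) (injective_of_isIso _)

end SmashCoalg

/-! ### The complex of a coalgebra -/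

namespace SmashCoalg

open FinBasedCW

/-- The underlying based set of a coalgebra, with every element other than the base point
replaced by three copies of it. -/
abbrev Points (X : SmashCoalg) : Type := Option (X.carrier × Fin 3)

/-- The action of a partial map on tripled points. -/
def mapPoints {α β : Type} (f : α → Option β) : Option (α × Fin 3) → Option (β × Fin 3) :=
  fun o => o.bind fun p => (f p.1).map fun y => (y, p.2)

theorem mapPoints_bind {α β γ : Type} (f : α → Option β) (g : β → Option γ)
    (o : Option (α × Fin 3)) :
    mapPoints (fun x => (f x).bind g) o = mapPoints g (mapPoints f o) := by
  cases o with
  | none => rfl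
  | some p =>
    cases h : f p.1 <;> simp [mapPoints, h]

theorem mapPoints_some {α : Type} (o : Option (α × Fin 3)) : mapPoints some o = o := by
  cases o <;> rfl

variable {X Y Z : SmashCoalg}

/-- The discrete complex on the tripled points of a coalgebra, with cells named through a
permutation. -/
noncomputable abbrev complex (X : SmashCoalg) (π : Equiv.Perm X.Points) : FinBasedCW :=
  discrete X.Points none π

/-- The based cellular map underlying a morphism of coalgebras. -/
noncomputable def complexMap (f : X ⟶ Y) (π : Equiv.Perm X.Points) (ρ : Equiv.Perm Y.Points) :
    X.complex π ⟶ Y.complex ρ :=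
  zeroDim_discrete.homMk (mapPoints (Hom.toFun f)) rfl fun _ =>
    zeroDim_discrete.mem_skeleton _

theorem complexMap_id (π : Equiv.Perm X.Points) : complexMap (𝟙 X) π π = 𝟙 _ :=
  FinBasedCW.hom_ext fun x => mapPoints_some x

theorem complexMap_comp (f : X ⟶ Y) (g : Y ⟶ Z) (π ρ σ) :
    complexMap (f ≫ g) π σ = complexMap f π ρ ≫ complexMap g ρ σ :=
  FinBasedCW.hom_ext fun x => mapPoints_bind _ _ x

theorem complexMap_injective {f g : X ⟶ Y} {π ρ} (h : complexMap f π ρ = complexMap g π ρ) :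
    f = g := by
  ext1 x
  have h' : mapPoints (Hom.toFun f) (some (x, 0)) = mapPoints (Hom.toFun g) (some (x, 0)) :=
    congrArg (fun k => FinBasedCW.Hom.toMap k (some (x, 0) : X.Points)) h
  exact Option.map_injective (fun _ _ e => congrArg Prod.fst e) h'

/-- Renaming the cells of the complex of a coalgebra is an isomorphism. -/
noncomputable def complexIso (X : SmashCoalg) (π ρ : Equiv.Perm X.Points) :
    X.complex π ≅ X.complex ρ where
  hom := complexMap (𝟙 X) π ρ
  inv := complexMap (𝟙 X) ρ π
  hom_inv_id := by rw [← complexMap_comp, Category.id_comp, complexMap_id]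
  inv_hom_id := by rw [← complexMap_comp, Category.id_comp, complexMap_id]

theorem complexIso_naturality (f : X ⟶ Y) (π π' ρ ρ') :
    complexMap f π ρ ≫ (complexIso Y ρ ρ').hom = (complexIso X π π').hom ≫ complexMap f π' ρ' := by
  simp only [complexIso]
  rw [← complexMap_comp, ← complexMap_comp, Category.id_comp, Category.comp_id]

/-- The functor sending a coalgebra to the discrete complex on its tripled points. -/
noncomputable def realization : SmashCoalg ⥤ FinBasedCW where
  obj X := X.complex 1
  map f := complexMap f 1 1
  map_id _ := complexMap_id 1
  map_comp f g := complexMap_comp f g 1 1 1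

theorem injective_iff (f : X ⟶ Y) :
    injective f ↔ Function.Injective (mapPoints (Hom.toFun f)) := by
  constructor
  · rintro ⟨j, hj, hf⟩ (_ | ⟨x, s⟩) (_ | ⟨y, t⟩) h
    · rfl
    · simp [mapPoints, hf] at h
    · simp [mapPoints, hf] at h
    · simpa [mapPoints, hf, hj.eq_iff] using h
  · intro h
    have hs : ∀ x, ∃ y, Hom.toFun f x = some y := by
      intro x
      cases hx : Hom.toFun f x with
      | some y => exact ⟨y, rfl⟩
      | none =>
        have : some (x, (0 : Fin 3)) = none := h <| by simp [mapPoints, hx]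
        simp at this
    choose j hj using hs
    refine ⟨j, fun x x' e => ?_, hj⟩
    have : some (x, (0 : Fin 3)) = some (x', 0) := h <| by simp [mapPoints, hj, e]
    simpa using this

theorem cellularInclusion_complexMap (f : X ⟶ Y) (π ρ) :
    cellularInclusion (complexMap f π ρ) ↔ injective f :=
  (zeroDim_discrete.cellularInclusion_iff zeroDim_discrete _).trans (injective_iff f).symm

theorem isZero_realization (hX : IsZero X) : IsZero (realization.obj X) := by
  have := isZero_iff.1 hX
  have hp : ∀ x : X.Points, x = none := by
    rintro (_ | x)
    · rfl
    · exact isEmptyElim x.1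
  refine ⟨fun Y => ⟨⟨⟨zeroDim_discrete.homMk (fun _ => Y.base) rfl fun _ => Y.base_mem⟩,
    fun f => FinBasedCW.hom_ext fun x => ?_⟩⟩, fun Y => ?_⟩
  · rw [hp x]
    exact f.map_base
  · let c : Y ⟶ realization.obj X :=
      ({ toMap := ContinuousMap.const _ (none : X.Points)
         map_base := rfl
         cellular := fun n x _ => Topology.CWComplex.skeleton_mono (by exact_mod_cast Nat.zero_le n)
          (realization.obj X).base_mem } : FinBasedCW.Hom Y (realization.obj X))
    exact ⟨⟨⟨c⟩, fun f => FinBasedCW.hom_ext fun x => hp _⟩⟩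

theorem isPushout_realization_pushoutObj {A B A' : SmashCoalg} {i : A ⟶ B} (hi : injective i)
    (f : A ⟶ A') :
    IsPushout (realization.map i) (realization.map f) (realization.map (pushoutInl f hi))
      (realization.map (pushoutInr i f)) := by
  refine isPushout_of_desc ?_ (fun {W} k h w => ?_) fun {W} l l' h₁ h₂ => ?_
  · rw [← Functor.map_comp, pushout_condition, Functor.map_comp]
  · have w' : ∀ x : A.Points, FinBasedCW.Hom.toMap k (mapPoints (Hom.toFun i) x) =
        FinBasedCW.Hom.toMap h (mapPoints (Hom.toFun f) x) :=
      fun x => congrArg (fun g => FinBasedCW.Hom.toMap g x) w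
    let l : (pushoutObj i f).Points → W.carrier := fun o =>
      match o with
      | none => W.base
      | some (Sum.inl a', t) => FinBasedCW.Hom.toMap h (some (a', t) : A'.Points)
      | some (Sum.inr b, t) => FinBasedCW.Hom.toMap k (some (b.1, t) : B.Points)
    have hl : ∀ x : (pushoutObj i f).Points,
        l x ∈ Topology.CWComplex.skeleton (Set.univ : Set W.carrier) 0 := by
      rintro (_ | ⟨a' | b, t⟩)
      · exact W.base_mem
      · exact zeroDim_discrete.map_mem h _
      · exact zeroDim_discrete.map_mem k _
    have hk : ∀ x : B.Points, l (mapPoints (pushoutMap i f) x) = FinBasedCW.Hom.toMap k x := by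
      rintro (_ | ⟨b, t⟩)
      · exact k.map_base.symm
      · by_cases hb : ∃ a, Hom.toFun i a = some b
        · obtain ⟨a, ha⟩ := hb
          have h₁ := w' (some (a, t))
          have h₂ : mapPoints (Hom.toFun i) (some (a, t)) = some (b, t) := by
            simp [mapPoints, ha]
          rw [h₂] at h₁
          rw [h₁]
          simp only [mapPoints, Option.bind_some, pushoutMap_of_injective i f hi ha]
          cases Hom.toFun f a with
          | none => exact h.map_base.symm
          | some a' => rfl
        · have := pushoutMap_compl i f ⟨b, not_exists.1 hb⟩
          simp only at this
          simp only [mapPoints, Option.bind_some, this]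
          rfl
    refine ⟨zeroDim_discrete.homMk (X := realization.obj (pushoutObj i f)) l rfl hl,
      FinBasedCW.hom_ext hk, FinBasedCW.hom_ext ?_⟩
    rintro (_ | ⟨a', t⟩)
    · exact h.map_base.symm
    · rfl
  · refine FinBasedCW.hom_ext ?_
    rintro (_ | ⟨a' | b, t⟩)
    · exact l.map_base.trans l'.map_base.symm
    · exact congrArg (fun g => FinBasedCW.Hom.toMap g (some (a', t) : A'.Points)) h₂
    · have h₃ := congrArg (fun g => FinBasedCW.Hom.toMap g (some (b.1, t) : B.Points)) h₁
      have h₄ : mapPoints (pushoutMap i f) (some (b.1, t)) = some (Sum.inr b, t) := by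
        simp [mapPoints, pushoutMap_compl]
      change FinBasedCW.Hom.toMap l (mapPoints (pushoutMap i f) (some (b.1, t))) =
        FinBasedCW.Hom.toMap l' (mapPoints (pushoutMap i f) (some (b.1, t))) at h₃
      rwa [h₄] at h₃

/-- The realization preserves pushouts of injections. -/
theorem isPushout_realization {A B A' P : SmashCoalg} {i : A ⟶ B} {f : A ⟶ A'} {g : B ⟶ P}
    {i' : A' ⟶ P} (h : IsPushout i f g i') (hi : injective i) :
    IsPushout (realization.map i) (realization.map f) (realization.map g)
      (realization.map i') := by
  obtain ⟨e, rfl, rfl⟩ := h.exists_iso_pushoutObj f hi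
  exact (isPushout_realization_pushoutObj hi f).of_iso (Iso.refl _) (Iso.refl _) (Iso.refl _)
    (realization.mapIso e) (by simp) (by simp) (by simp) (by simp)

end SmashCoalg

/-! ### The subcategory of complexes of coalgebras -/

namespace SmashCoalg

open FinBasedCW

/-- A coalgebra structure on the based set `Option (Fin m)`, for some `m`. -/
abbrev Code : Type := Σ m : ℕ, Fin m → Option (Fin m × Fin m)

/-- The coalgebra described by a code. -/
abbrev ofCode (c : Code) : SmashCoalg := ⟨Fin c.1, c.2⟩

/-- A set tripled has enough permutations to tell apart all coalgebra structures on it: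
`(m ^ 2 + 1) ^ m ≤ (3 * m + 1)!`. -/
theorem nonempty_embedding_perm (m : ℕ) :
    Nonempty ((Fin m → Option (Fin m × Fin m)) ↪ Equiv.Perm (Option (Fin m × Fin 3))) := by
  refine Function.Embedding.nonempty_of_card_le ?_
  rw [Fintype.card_perm]
  simp only [Fintype.card_fun, Fintype.card_option, Fintype.card_prod, Fintype.card_fin]
  calc (m * m + 1) ^ m ≤ ((m + 1) ^ 2) ^ m := Nat.pow_le_pow_left (by nlinarith) m
    _ = (m + 1) ^ (2 * m) := (pow_mul _ _ _).symm
    _ ≤ m.factorial * (m + 1) ^ (2 * m) := Nat.le_mul_of_pos_left _ m.factorial_pos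
    _ ≤ (m + 2 * m).factorial := Nat.factorial_mul_pow_le_factorial
    _ ≤ (m * 3 + 1).factorial := Nat.factorial_le (by lia)

/-- A permutation of the tripled points that determines the coalgebra structure. -/
noncomputable def codePerm (c : Code) : Equiv.Perm (ofCode c).Points :=
  (nonempty_embedding_perm c.1).some c.2

/-- The complex of a coded coalgebra, with cells named so that the code can be recovered. -/
noncomputable abbrev codeComplex (c : Code) : FinBasedCW := (ofCode c).complex (codePerm c)

/-- The size of the space determines `m`, and the names of the cells determine the structure. -/
theorem codeComplex_injective : Function.Injective codeComplex := by
  rintro ⟨m, p⟩ ⟨n, q⟩ h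
  have hmn : m = n := by
    have h' : Option (Fin m × Fin 3) = Option (Fin n × Fin 3) := congrArg FinBasedCW.carrier h
    have := Fintype.card_congr (Equiv.cast h')
    simpa using this
  subst hmn
  have : p = q := (nonempty_embedding_perm m).some.injective (perm_eq_of_discrete_eq h)
  rw [this]

/-- The morphism of complexes underlying a morphism of coded coalgebras. -/
noncomputable def codeMap {c d : Code} (g : ofCode c ⟶ ofCode d) :
    codeComplex c ⟶ codeComplex d :=
  complexMap g (codePerm c) (codePerm d)

theorem codeMap_id (c : Code) : codeMap (𝟙 (ofCode c)) = 𝟙 (codeComplex c) := complexMap_id _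

theorem codeMap_comp {c d e : Code} (g : ofCode c ⟶ ofCode d) (k : ofCode d ⟶ ofCode e) :
    codeMap (g ≫ k) = codeMap g ≫ codeMap k := complexMap_comp _ _ _ _ _

theorem codeMap_injective {c d : Code} {g k : ofCode c ⟶ ofCode d} (h : codeMap g = codeMap k) :
    g = k := complexMap_injective h

/-- The subcategory of finite based CW complexes given by the complexes of coded coalgebras and the
maps underlying morphisms of coalgebras. It is not closed under isomorphisms: the names of the cells
determine the coalgebra, and with it which maps belong to the subcategory. Equalities of objects
are accounted for by `eqToHom`. -/
noncomputable def subcategory : Subcategory FinBasedCW where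
  obj X := ∃ c, codeComplex c = X
  hom X Y f := ∃ (c d : Code) (g : ofCode c ⟶ ofCode d) (hc : codeComplex c = X)
    (hd : codeComplex d = Y), f = eqToHom hc.symm ≫ codeMap g ≫ eqToHom hd
  source_mem := by
    rintro X Y f ⟨c, d, g, hc, hd, -⟩
    exact ⟨c, hc⟩
  target_mem := by
    rintro X Y f ⟨c, d, g, hc, hd, -⟩
    exact ⟨d, hd⟩
  id_mem := by
    rintro X ⟨c, rfl⟩
    refine ⟨c, c, 𝟙 _, rfl, rfl, ?_⟩
    simp [codeMap_id]
  comp_mem := by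
    rintro X Y Z _ _ ⟨c, d, g, rfl, rfl, rfl⟩ ⟨d', e, k, hd, rfl, rfl⟩
    obtain rfl := codeComplex_injective hd
    refine ⟨c, e, g ≫ k, rfl, rfl, ?_⟩
    simp [codeMap_comp]

namespace subcategory

/-- The code of an object of the subcategory. -/
noncomputable def code (X : subcategory.Obj) : Code := X.property.choose

theorem codeComplex_code (X : subcategory.Obj) : codeComplex (code X) = X.val :=
  X.property.choose_spec

theorem exists_eq_codeMap {X Y : subcategory.Obj} (f : X ⟶ Y) :
    ∃ g : ofCode (code X) ⟶ ofCode (code Y),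
      f.1 = eqToHom (codeComplex_code X).symm ≫ codeMap g ≫ eqToHom (codeComplex_code Y) := by
  obtain ⟨c, d, g, hc, hd, h⟩ := f.2
  obtain rfl := codeComplex_injective (hc.trans (codeComplex_code X).symm)
  obtain rfl := codeComplex_injective (hd.trans (codeComplex_code Y).symm)
  exact ⟨g, h⟩

/-- The morphism of coalgebras underlying a morphism of the subcategory. -/
noncomputable def coalgHom {X Y : subcategory.Obj} (f : X ⟶ Y) :
    ofCode (code X) ⟶ ofCode (code Y) := (exists_eq_codeMap f).choose

theorem codeMap_coalgHom {X Y : subcategory.Obj} (f : X ⟶ Y) :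
    codeMap (coalgHom f) =
      eqToHom (codeComplex_code X) ≫ f.1 ≫ eqToHom (codeComplex_code Y).symm := by
  rw [(exists_eq_codeMap f).choose_spec]
  simp [coalgHom]

theorem comp_val {X Y Z : subcategory.Obj} (f : X ⟶ Y) (g : Y ⟶ Z) : (f ≫ g).1 = f.1 ≫ g.1 := rfl

theorem id_val (X : subcategory.Obj) : (𝟙 X : X ⟶ X).1 = 𝟙 X.val := rfl

/-- The equivalence from the subcategory to the category of coalgebras. -/
noncomputable def toCoalg : subcategory.Obj ⥤ SmashCoalg where
  obj X := ofCode (code X)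
  map f := coalgHom f
  map_id X := codeMap_injective <| by
    rw [codeMap_coalgHom, id_val, codeMap_id, Category.id_comp, eqToHom_trans, eqToHom_refl]
  map_comp f g := codeMap_injective <| by
    rw [codeMap_coalgHom, codeMap_comp, codeMap_coalgHom, codeMap_coalgHom, comp_val]
    simp

instance : toCoalg.Faithful where
  map_injective {X Y f g} h := by
    have h' : codeMap (coalgHom f) = codeMap (coalgHom g) := congrArg codeMap h
    rw [codeMap_coalgHom, codeMap_coalgHom] at h'
    rw [cancel_epi, cancel_mono] at h'
    exact Subtype.ext h'

instance : toCoalg.Full where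
  map_surjective {X Y} g := by
    refine ⟨⟨eqToHom (codeComplex_code X).symm ≫ codeMap g ≫ eqToHom (codeComplex_code Y),
      ⟨_, _, g, codeComplex_code X, codeComplex_code Y, rfl⟩⟩, ?_⟩
    refine codeMap_injective ((codeMap_coalgHom _).trans ?_)
    simp

instance : toCoalg.EssSurj where
  mem_essImage Y := by
    obtain ⟨m, ⟨e⟩⟩ := Finite.exists_equiv_fin Y.carrier
    let c : Code := ⟨m, fun x => (Y.op (e.symm x)).map (Prod.map e e)⟩
    let X : subcategory.Obj := ⟨codeComplex c, c, rfl⟩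
    have hX : code X = c := codeComplex_injective (codeComplex_code X)
    exact ⟨X, ⟨eqToIso (congrArg ofCode hX) ≪≫
      (isoOfEquiv (X := Y) (Y := ofCode c) e fun x => by simp [c]).symm⟩⟩

instance : toCoalg.IsEquivalence where

/-- On the subcategory, the realization of the underlying coalgebra is the given complex with its
cells renamed. -/
noncomputable def inclusionIso : subcategory.inclusion ≅ toCoalg ⋙ realization :=
  NatIso.ofComponents
    (fun X => eqToIso (codeComplex_code X).symm ≪≫ complexIso _ (codePerm (code X)) 1)
    fun {X Y} f => by
      have h : f.1 = eqToHom (codeComplex_code X).symm ≫ codeMap (coalgHom f) ≫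
          eqToHom (codeComplex_code Y) := by
        rw [codeMap_coalgHom]
        simp
      change f.1 ≫ eqToHom (codeComplex_code Y).symm ≫ (complexIso _ _ 1).hom =
        (eqToHom (codeComplex_code X).symm ≫ (complexIso _ _ 1).hom) ≫
          complexMap (coalgHom f) 1 1
      rw [h, Category.assoc _ (complexIso _ _ _).hom, ← complexIso_naturality]
      simp only [Category.assoc, eqToHom_trans_assoc, eqToHom_refl, Category.id_comp]
      rfl

end subcategory

end SmashCoalg

/-! ### Exactness -/

section Exact

variable {C D : Type*} [Category C] [Category D]

theorem isZero_of_isZero_map (F : C ⥤ D) [F.Full] [F.Faithful] {X : C} (h : IsZero (F.obj X)) :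
    IsZero X :=
  ⟨fun _ => ⟨⟨⟨F.preimage (h.to_ _)⟩, fun _ => F.map_injective (h.eq_of_src _ _)⟩⟩,
    fun _ => ⟨⟨⟨F.preimage (h.from_ _)⟩, fun _ => F.map_injective (h.eq_of_tgt _ _)⟩⟩⟩

theorem isZero_map_of_isZero (F : C ⥤ D) [F.IsEquivalence] {X : C} (h : IsZero X) :
    IsZero (F.obj X) :=
  isZero_of_isZero_map F.inv (h.of_iso (F.asEquivalence.unitIso.app X).symm)

/-- An equivalence that detects cofibrations is exact. -/
theorem isExact_of_isEquivalence {cofC : MorphismProperty C} {cofD : MorphismProperty D}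
    (F : C ⥤ D) [F.IsEquivalence] (hF : ∀ {A B : C} (f : A ⟶ B), cofC f ↔ cofD (F.map f)) :
    IsExact cofC cofD F where
  map_zero _ := isZero_map_of_isZero F
  map_cof f := (hF f).1
  map_pushout _ _ _ _ h _ := h.map F

theorem IsCategoryWithCofibrations.comp_iso_iff {cof : MorphismProperty C}
    (h : IsCategoryWithCofibrations cof) {A B A' B' : C} {f : A ⟶ B} {f' : A' ⟶ B'} (e : A ≅ A')
    (e' : B ≅ B') (w : f ≫ e'.hom = e.hom ≫ f') : cof f ↔ cof f' := by
  constructor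
  · intro hf
    have : f' = e.inv ≫ f ≫ e'.hom := by rw [w, e.inv_hom_id_assoc]
    rw [this]
    exact h.comp _ _ (h.of_isIso _ inferInstance) (h.comp _ _ hf (h.of_isIso _ inferInstance))
  · intro hf
    have : f = e.hom ≫ f' ≫ e'.inv := by rw [← reassoc_of% w, e'.hom_inv_id, Category.comp_id]
    rw [this]
    exact h.comp _ _ (h.of_isIso _ inferInstance) (h.comp _ _ hf (h.of_isIso _ inferInstance))

theorem isExact_inv {cofC : MorphismProperty C} {cofD : MorphismProperty D}
    (F : C ⥤ D) [F.IsEquivalence] (hF : ∀ {A B : C} (f : A ⟶ B), cofC f ↔ cofD (F.map f))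
    (hD : IsCategoryWithCofibrations cofD) : IsExact cofD cofC F.inv :=
  isExact_of_isEquivalence F.inv fun {A B} f => by
    rw [hF]
    exact hD.comp_iso_iff (F.asEquivalence.counitIso.app A).symm
      (F.asEquivalence.counitIso.app B).symm (F.asEquivalence.counitIso.inv.naturality f)

/-- Categories with cofibrations can be transported along equivalences. -/
theorem IsCategoryWithCofibrations.of_isEquivalence {cofC : MorphismProperty C}
    {cofD : MorphismProperty D} (F : C ⥤ D) [F.IsEquivalence]
    (hF : ∀ {A B : C} (f : A ⟶ B), cofC f ↔ cofD (F.map f))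
    (hD : IsCategoryWithCofibrations cofD) : IsCategoryWithCofibrations cofC where
  exists_zero := by
    obtain ⟨Z, hZ⟩ := hD.exists_zero
    exact ⟨F.inv.obj Z, isZero_map_of_isZero _ hZ⟩
  zero_to f hZ := (hF f).2 (hD.zero_to _ (isZero_map_of_isZero F hZ))
  of_isIso f _ := (hF f).2 (hD.of_isIso _ inferInstance)
  comp f g h₁ h₂ := by
    rw [hF, F.map_comp]
    exact hD.comp _ _ ((hF f).1 h₁) ((hF g).1 h₂)
  exists_pushout i f hi := by
    obtain ⟨P, g, i', h⟩ := hD.exists_pushout (F.map i) (F.map f) ((hF i).1 hi)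
    let e := F.objObjPreimageIso P
    refine ⟨F.objPreimage P, F.preimage (g ≫ e.inv), F.preimage (i' ≫ e.inv), ?_⟩
    refine IsPushout.of_map_of_faithful F ?_
    exact h.of_iso (Iso.refl _) (Iso.refl _) (Iso.refl _) e.symm (by simp) (by simp) (by simp)
      (by simp)
  of_isPushout i f g i' h hi := (hF i').2 (hD.of_isPushout _ _ _ _ (h.map F) ((hF i).1 hi))

theorem IsExact.isCokernel_map {cofC : MorphismProperty C} {cofD : MorphismProperty D} {F : C ⥤ D}
    (hF : IsExact cofC cofD F) {A B Q : C} {i : A ⟶ B} {q : B ⟶ Q} (hi : cofC i)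
    (h : IsCokernel i q) : IsCokernel (F.map i) (F.map q) := by
  obtain ⟨Z, hZ, h⟩ := h
  refine ⟨F.obj Z, hF.map_zero Z hZ, ?_⟩
  have := hF.map_pushout _ _ _ _ h hi
  rwa [(hF.map_zero Z hZ).eq_of_tgt (F.map (hZ.from_ A)) ((hF.map_zero Z hZ).from_ _),
    (hF.map_zero Z hZ).eq_of_src (F.map (hZ.to_ Q)) ((hF.map_zero Z hZ).to_ _)] at this

/-- Exact functors act on the `S`-construction. -/
theorem IsSObject.comp {cofC : MorphismProperty C} {cofD : MorphismProperty D} {F : C ⥤ D}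
    (hF : IsExact cofC cofD F) {I : Type} [LinearOrder I] {A : Ar I ⥤ C} (hA : IsSObject cofC I A) :
    IsSObject cofD I (A ⋙ F) where
  isZero j := hF.map_zero _ (hA.isZero j)
  sequence hij hjk :=
    ⟨hF.map_cof _ (hA.sequence hij hjk).1,
      hF.isCokernel_map (hA.sequence hij hjk).1 (hA.sequence hij hjk).2⟩

end Exact

namespace Subcategory

variable {C : Type*} [Category C]

theorem eq_of_contains {A B : Subcategory C} (h : A.Contains B) (h' : B.Contains A) : A = B := by
  have ho : A.obj = B.obj := funext fun X => propext ⟨h'.obj X, h.obj X⟩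
  have hh : A.hom = B.hom := by
    ext X Y f
    exact ⟨h'.hom f, h.hom f⟩
  cases A
  cases B
  cases ho
  cases hh
  rfl

/-- A subcategory with cofibrations generates itself. -/
theorem generated_eq_self {cof : MorphismProperty C} {A : Subcategory C}
    (h : A.IsSubcategoryWithCofibrations cof) : A.generated cof = A :=
  eq_of_contains ⟨fun _ hX _ _ hB => hB.obj _ hX, fun _ hf _ _ hB => hB.hom _ hf⟩
    ⟨fun _ hX => hX A h ⟨fun _ => id, fun _ => id⟩, fun _ hf => hf A h ⟨fun _ => id, fun _ => id⟩⟩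

end Subcategory

namespace SmashCoalg.subcategory

open FinBasedCW

variable {X Y A B A' P : subcategory.Obj}

theorem cellularInclusion_iff (f : X ⟶ Y) :
    cellularInclusion f.1 ↔ injective (toCoalg.map f) := by
  have key : ∀ {c d : Code} {X Y : FinBasedCW} (hc : codeComplex c = X) (hd : codeComplex d = Y)
      (g : ofCode c ⟶ ofCode d),
      cellularInclusion (eqToHom hc.symm ≫ codeMap g ≫ eqToHom hd) ↔ injective g := by
    rintro c d _ _ rfl rfl g
    simp only [eqToHom_refl, Category.comp_id, Category.id_comp]
    exact cellularInclusion_complexMap g (codePerm c) (codePerm d)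
  rw [(exists_eq_codeMap f).choose_spec]
  exact key (codeComplex_code X) (codeComplex_code Y) (coalgHom f)

/-- The inclusion preserves pushouts of injections. -/
theorem isPushout_inclusion {i : A ⟶ B} {f : A ⟶ A'} {g : B ⟶ P} {i' : A' ⟶ P}
    (h : IsPushout i f g i') (hi : injective (toCoalg.map i)) :
    IsPushout i.1 f.1 g.1 i'.1 :=
  (isPushout_realization (h.map toCoalg) hi).of_iso (inclusionIso.symm.app A)
    (inclusionIso.symm.app B) (inclusionIso.symm.app A') (inclusionIso.symm.app P)
    (inclusionIso.inv.naturality i) (inclusionIso.inv.naturality f)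
    (inclusionIso.inv.naturality g) (inclusionIso.inv.naturality i')

theorem isZero_val (hX : IsZero X) : IsZero X.val :=
  (isZero_realization (isZero_map_of_isZero toCoalg hX)).of_iso (inclusionIso.app X)

/-- The cofibrations of the subcategory are all its injections: the cokernel of an injection is
realized by an object of the subcategory. -/
theorem cofibrations_iff (f : X ⟶ Y) :
    subcategory.cofibrations cellularInclusion f ↔ injective (toCoalg.map f) := by
  refine ⟨fun h => (cellularInclusion_iff f).1 h.1, fun h => ⟨(cellularInclusion_iff f).2 h, ?_⟩⟩
  have hC : IsCategoryWithCofibrations (injective.inverseImage toCoalg) :=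
    isCategoryWithCofibrations_injective.of_isEquivalence toCoalg fun _ => Iff.rfl
  obtain ⟨Z, hZ⟩ := hC.exists_zero
  obtain ⟨Q, q, z, hq⟩ := hC.exists_pushout f (hZ.from_ X) h
  refine ⟨Q.val, q.1, Q.property, Z.val, isZero_val hZ, ?_⟩
  have := isPushout_inclusion hq h
  rwa [(isZero_val hZ).eq_of_tgt (hZ.from_ X).1 ((isZero_val hZ).from_ _),
    (isZero_val hZ).eq_of_src z.1 ((isZero_val hZ).to_ _)] at this

theorem isExact_toCoalg :
    IsExact (subcategory.cofibrations cellularInclusion) injective toCoalg :=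
  isExact_of_isEquivalence toCoalg cofibrations_iff

theorem isExact_toCoalg_inv :
    IsExact injective (subcategory.cofibrations cellularInclusion) toCoalg.inv :=
  isExact_inv toCoalg cofibrations_iff isCategoryWithCofibrations_injective

theorem isSubcategoryWithCofibrations :
    subcategory.IsSubcategoryWithCofibrations cellularInclusion where
  isCategoryWithCofibrations :=
    isCategoryWithCofibrations_injective.of_isEquivalence toCoalg cofibrations_iff
  isExact_inclusion :=
    { map_zero := fun _ => isZero_val
      map_cof := fun _ h => h.1
      map_pushout := fun i _ _ _ h hi => isPushout_inclusion h ((cofibrations_iff i).1 hi) }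

theorem containsZero : subcategory.ContainsZero := by
  obtain ⟨Z, hZ⟩ := isSubcategoryWithCofibrations.isCategoryWithCofibrations.exists_zero
  refine ⟨Z.val, isZero_val hZ, Z.property, fun X hX => ⟨fun f => ?_, fun f => ?_⟩⟩
  · rw [(isZero_val hZ).eq_of_tgt f (hZ.from_ (⟨X, hX⟩ : subcategory.Obj)).1]
    exact (hZ.from_ (⟨X, hX⟩ : subcategory.Obj)).2
  · rw [(isZero_val hZ).eq_of_src f (hZ.to_ (⟨X, hX⟩ : subcategory.Obj)).1]
    exact (hZ.to_ (⟨X, hX⟩ : subcategory.Obj)).2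

end SmashCoalg.subcategory

/-! ### Filtered coalgebras -/

namespace SmashCoalg

section Filtration

variable {I : Type} [LinearOrder I] {B : SmashCoalg} (l : B.carrier → I)

open Classical in
/-- The partial map to the set of elements of level in the half-open interval from `x` to `y`. -/
noncomputable def toLayer (x y : I) (b : B.carrier) : Option {b // x < l b ∧ l b ≤ y} :=
  if h : x < l b ∧ l b ≤ y then some ⟨b, h⟩ else none

theorem toLayer_of_mem {x y : I} {b : B.carrier} (h : x < l b ∧ l b ≤ y) :
    toLayer l x y b = some ⟨b, h⟩ := dif_pos h

theorem toLayer_of_notMem {x y : I} {b : B.carrier} (h : ¬ (x < l b ∧ l b ≤ y)) :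
    toLayer l x y b = none := dif_neg h

/-- The subquotient of `B` formed by the elements of level in the half-open interval from `x`
to `y`. -/
noncomputable abbrev layer (x y : I) : SmashCoalg where
  carrier := {b // x < l b ∧ l b ≤ y}
  op b := (B.op b.1).bind (smash (toLayer l x y))

theorem toLayer_bind {x y x' y' : I} (hx : x ≤ x') {b : B.carrier} (hb : l b ≤ y) :
    (toLayer l x y b).bind (fun c => toLayer l x' y' c.1) = toLayer l x' y' b := by
  by_cases h : x < l b
  · rw [toLayer_of_mem l ⟨h, hb⟩]
    rfl
  · rw [toLayer_of_notMem l fun h' => h h'.1, toLayer_of_notMem l fun h' => h (hx.trans_lt h'.1)]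
    rfl

/-- The level of the entries of `op b` does not exceed the level of `b`: the elements up to a given
level form a subobject. -/
def IsFiltration : Prop := ∀ b p, B.op b = some p → l p.1 ≤ l b ∧ l p.2 ≤ l b

variable {l}

/-- The map between layers given by the identity on common elements. -/
noncomputable def layerMap (hl : IsFiltration l) {x y x' y' : I} (hx : x ≤ x') (hy : y ≤ y') :
    layer l x y ⟶ layer l x' y' :=
  (⟨fun b => toLayer l x' y' b.1, fun b => by
    change _ = ((B.op b.1).bind _).bind _
    rw [Option.bind_assoc]
    simp_rw [← smash_bind]
    have key : ∀ p, B.op b.1 = some p →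
        smash (fun c => (toLayer l x y c).bind fun c => toLayer l x' y' c.1) p =
          smash (toLayer l x' y') p := by
      intro p hp
      obtain ⟨h₁, h₂⟩ := hl _ _ hp
      simp only [smash, toLayer_bind l hx (h₁.trans b.2.2), toLayer_bind l hx (h₂.trans b.2.2)]
    cases hp : B.op b.1 with
    | none =>
      by_cases h : x' < l b.1 ∧ l b.1 ≤ y'
      · rw [toLayer_of_mem l h]
        simp [hp]
      · rw [toLayer_of_notMem l h]
        rfl
    | some p =>
      rw [Option.bind_some, key p hp]
      by_cases h : x' < l b.1 ∧ l b.1 ≤ y'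
      · rw [toLayer_of_mem l h]
        simp [hp]
      · have h' : l b.1 ≤ x' := not_lt.1 fun h' => h ⟨h', b.2.2.trans hy⟩
        rw [toLayer_of_notMem l h, smash,
          toLayer_of_notMem l fun h => absurd (h.1.trans_le ((hl _ _ hp).1.trans h')) (lt_irrefl _)]
        rfl⟩ : Hom (layer l x y) (layer l x' y'))

/-- The subquotients of a filtered coalgebra `B`: the value at `(x, y)` is the quotient of the
subobject of level at most `y` by the subobject of level at most `x`. -/
noncomputable def layers (hl : IsFiltration l) : Ar I ⥤ SmashCoalg where
  obj p := layer l p.1.1 p.1.2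
  map f := layerMap hl (leOfHom f).1 (leOfHom f).2
  map_id _ := hom_ext fun b => toLayer_of_mem l b.2
  map_comp f g := hom_ext fun b =>
    (toLayer_bind l (leOfHom g).1 (b.2.2.trans (leOfHom f).2)).symm

theorem isCokernel_layerMap (hl : IsFiltration l) {x y z : I} (hxy : x ≤ y) (hyz : y ≤ z) :
    IsCokernel (layerMap hl le_rfl hyz : layer l x y ⟶ layer l x z) (layerMap hl hxy le_rfl) := by
  obtain ⟨Z, hZ⟩ := isCategoryWithCofibrations_injective.exists_zero
  have hbind : ∀ {V W : SmashCoalg} (k : V ⟶ Z) (m : Z ⟶ W) (v : V.carrier),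
      (Hom.toFun k v).bind (Hom.toFun m) = none := by
    intro V W k m v
    cases Hom.toFun k v with
    | none => rfl
    | some z => exact ((isZero_iff.1 hZ).false z).elim
  refine ⟨Z, hZ, isPushout_of_desc ?_ (fun {W} k m w => ?_) fun {W} k k' h₁ _ => ?_⟩
  · ext1 b
    refine (toLayer_bind l hxy (b.2.2.trans hyz)).trans ?_
    rw [toLayer_of_notMem l fun h => absurd (h.1.trans_le b.2.2) (lt_irrefl _)]
    exact (hbind (hZ.from_ (layer l x y)) (hZ.to_ (layer l y z)) b).symm
  · let t : (layer l y z).carrier → Option W.carrier := fun b =>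
      Hom.toFun k ⟨b.1, hxy.trans_lt b.2.1, b.2.2⟩
    have ht : ∀ b : B.carrier, (toLayer l x z b).bind (Hom.toFun k) = (toLayer l y z b).bind t := by
      intro b
      by_cases h : y < l b ∧ l b ≤ z
      · rw [toLayer_of_mem l h, toLayer_of_mem l ⟨hxy.trans_lt h.1, h.2⟩]
        rfl
      · rw [toLayer_of_notMem l h]
        by_cases h' : x < l b ∧ l b ≤ z
        · have hb : l b ≤ y := not_lt.1 fun hy => h ⟨hy, h'.2⟩
          have hw : (toLayer l x z b).bind (Hom.toFun k) = none :=
            (congr_toFun w ⟨b, h'.1, hb⟩).trans (hbind (hZ.from_ (layer l x y)) m ⟨b, h'.1, hb⟩)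
          rw [hw]
          rfl
        · rw [toLayer_of_notMem l h']
          rfl
    have comm : ∀ b, (t b).bind W.op = ((layer l y z).op b).bind (smash t) := by
      intro b
      refine (Hom.comm k _).trans ?_
      change ((B.op b.1).bind _).bind _ = ((B.op b.1).bind _).bind _
      rw [Option.bind_assoc, Option.bind_assoc]
      simp_rw [← smash_bind, ht]
    refine ⟨(⟨t, comm⟩ : Hom (layer l y z) W), hom_ext fun b => ?_, hom_ext fun z => ?_⟩
    · refine (ht b.1).symm.trans ?_
      rw [toLayer_of_mem l b.2]
      rfl
    · exact ((isZero_iff.1 hZ).false z).elim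
  · ext1 b
    have h : (toLayer l y z b.1).bind (Hom.toFun k) = (toLayer l y z b.1).bind (Hom.toFun k') :=
      congr_toFun h₁ ⟨b.1, hxy.trans_lt b.2.1, b.2.2⟩
    rwa [toLayer_of_mem l b.2] at h

theorem isSObject_layers (hl : IsFiltration l) : IsSObject injective I (layers hl) where
  isZero _ := isZero_iff.2 ⟨fun b => absurd (b.2.1.trans_le b.2.2) (lt_irrefl _)⟩
  sequence hij hjk :=
    ⟨⟨fun b => ⟨b.1, b.2.1, b.2.2.trans hjk.le⟩,
      fun _ _ h => Subtype.ext (congrArg (fun c => c.1) h), fun _ => toLayer_of_mem l _⟩,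
      isCokernel_layerMap hl hij.le hjk.le⟩

end Filtration

/-- Cokernels are surjective. -/
theorem exists_toFun_eq_of_isCokernel {A B Q : SmashCoalg} {i : A ⟶ B} {q : B ⟶ Q}
    (hi : injective i) (h : IsCokernel i q) (c : Q.carrier) : ∃ b, Hom.toFun q b = some c := by
  obtain ⟨Z, hZ, h⟩ := h
  obtain ⟨e, rfl, -⟩ := h.exists_iso_pushoutObj (hZ.from_ A) hi
  obtain ⟨k, -, hk⟩ := injective_of_isIso e.inv
  have hc : Hom.toFun (e.inv ≫ e.hom) c = some c := by rw [e.inv_hom_id]; rfl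
  rw [toFun_comp, hk, Option.bind_some] at hc
  cases hkc : k c with
  | inl z => exact ((isZero_iff.1 hZ).false z).elim
  | inr b =>
    rw [hkc] at hc
    refine ⟨b.1, ?_⟩
    rw [toFun_comp, toFun_pushoutInl, pushoutMap_compl]
    exact hc

/-- The operation takes every `b` over an element `c` of `C` to a pair whose first entry lies over
an element different from `c`. Hence a subobject of `B` with an element over `c` has elements over
at least two elements of `C`. -/
def IsLinked {B C : SmashCoalg} (q : B ⟶ C) : Prop :=
  ∀ b c, Hom.toFun q b = some c →
    ∃ b' w c', B.op b = some (b', w) ∧ Hom.toFun q b' = some c' ∧ c' ≠ c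

theorem IsLinked.of_iso {B C B' C' : SmashCoalg} {q : B ⟶ C} {q' : B' ⟶ C'} (h : IsLinked q)
    (e : B ≅ B') (e' : C ≅ C') (w : q ≫ e'.hom = e.hom ≫ q') : IsLinked q' := by
  intro b c hbc
  obtain ⟨j, -, hj⟩ := injective_of_isIso e.inv
  obtain ⟨k, -, hk⟩ := injective_of_isIso e.hom
  obtain ⟨m, hm, hm'⟩ := injective_of_isIso e'.hom
  have hw : ∀ x, (Hom.toFun q x).map m = Hom.toFun q' (k x) := by
    intro x
    have := congrArg (fun g => Hom.toFun g x) w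
    simp only [toFun_comp, hk, Option.bind_some] at this
    rw [← this, Option.map_eq_bind]
    exact congrArg _ (funext fun y => (hm' y).symm)
  have hkj : k (j b) = b := by
    have : Hom.toFun (e.inv ≫ e.hom) b = some b := by rw [e.inv_hom_id]; rfl
    rw [toFun_comp, hj, Option.bind_some, hk] at this
    exact Option.some_injective _ this
  have hb := hw (j b)
  rw [hkj, hbc, Option.map_eq_some_iff] at hb
  obtain ⟨c₀, hc₀, rfl⟩ := hb
  obtain ⟨b', v, c', hop, hb', hne⟩ := h _ _ hc₀
  refine ⟨k b', k v, m c', ?_, ?_, hm.ne hne⟩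
  · have := Hom.comm e.hom (j b)
    rw [hk, Option.bind_some, hkj, hop, Option.bind_some] at this
    rw [this, smash_eq_some]
    exact ⟨hk _, hk _⟩
  · rw [← hw, hb']
    rfl

/-- If `A_{h,k} ⟶ A_{i,k}` is linked, then `A_{i,j}` cannot have exactly one element. Indeed, lift
this element to `A_{h,j}`; the operation takes the lift to a pair whose first entry gives rise to
a second element of `A_{i,j}`. -/
theorem false_of_isLinked {I : Type} [LinearOrder I] {A : Ar I ⥤ SmashCoalg}
    (hA : IsSObject injective I A) {h i j k : I} (hi : h < i) (ij : i < j) (jk : j < k)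
    (hq : IsLinked (A.map (homOfLE (show Ar.mk (hi.trans (ij.trans jk)).le ≤
      Ar.mk (ij.trans jk).le from ⟨hi.le, le_rfl⟩))))
    (hs : Subsingleton (A.obj (Ar.mk ij.le)).carrier) (c : (A.obj (Ar.mk ij.le)).carrier) :
    False := by
  obtain ⟨h₁, h₂⟩ := hA.sequence hi ij
  -- `m` and `n` are the injections of `A_{h,j}` into `A_{h,k}` and of `A_{i,j}` into `A_{i,k}`.
  obtain ⟨m, -, hm⟩ := (hA.sequence (hi.trans ij) jk).1
  obtain ⟨n, -, hn⟩ := (hA.sequence ij jk).1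
  obtain ⟨d, hd⟩ := exists_toFun_eq_of_isCokernel h₁ h₂ c
  have w : ∀ x, Hom.toFun (A.map (homOfLE (show Ar.mk (hi.trans (ij.trans jk)).le ≤
      Ar.mk (ij.trans jk).le from ⟨hi.le, le_rfl⟩))) (m x) =
      (Hom.toFun (A.map (homOfLE (show Ar.mk (hi.trans ij).le ≤ Ar.mk ij.le from
        ⟨hi.le, le_rfl⟩))) x).map n := by
    intro x
    have : A.map (homOfLE (show Ar.mk (hi.trans ij).le ≤ Ar.mk ((hi.trans ij).trans jk).le from
        ⟨le_rfl, jk.le⟩)) ≫ A.map (homOfLE (show Ar.mk (hi.trans (ij.trans jk)).le ≤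
          Ar.mk (ij.trans jk).le from ⟨hi.le, le_rfl⟩)) =
        A.map (homOfLE (show Ar.mk (hi.trans ij).le ≤ Ar.mk ij.le from ⟨hi.le, le_rfl⟩)) ≫
        A.map (homOfLE (show Ar.mk ij.le ≤ Ar.mk (ij.trans jk).le from ⟨le_rfl, jk.le⟩)) := by
      rw [← A.map_comp, ← A.map_comp]
      rfl
    have := congrArg (fun g => Hom.toFun g x) this
    simp only [toFun_comp, hm, Option.bind_some] at this
    rw [this, Option.map_eq_bind]
    exact congrArg _ (funext hn)
  have hu := w d
  rw [hd, Option.map_some] at hu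
  obtain ⟨v, z, c', hop, hv, hne⟩ := hq _ _ hu
  have hcomm := Hom.comm (A.map (homOfLE (show Ar.mk (hi.trans ij).le ≤
    Ar.mk ((hi.trans ij).trans jk).le from ⟨le_rfl, jk.le⟩))) d
  rw [hm, Option.bind_some, hop, eq_comm, Option.bind_eq_some_iff] at hcomm
  obtain ⟨⟨d', z'⟩, -, hp⟩ := hcomm
  have hd' := (smash_eq_some.1 hp).1
  simp only [hm, Option.some.injEq] at hd'
  rw [← hd', w, Option.map_eq_some_iff] at hv
  obtain ⟨c'', -, rfl⟩ := hv
  exact hne (congrArg n (Subsingleton.elim _ _))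

end SmashCoalg

/-! ### Chords and triangles of triangulations -/

section Triangulations

variable {n : ℕ} {T : Finset (Finset (Fin (n + 1)))}

/-- For `a ≤ b`, the chord from `a` to `b` is not crossed by a side of a triangle of `T`: a triangle
with a vertex strictly between `a` and `b` has all its vertices between `a` and `b`. -/
def Uncrossed (T : Finset (Finset (Fin (n + 1)))) (a b : Fin (n + 1)) : Prop :=
  ∀ σ ∈ T, ∀ u ∈ σ, ∀ v ∈ σ, a < u → u < b → a ≤ v ∧ v ≤ b

theorem IsTriangulation.uncrossed (hT : IsTriangulation n T) {τ : Finset (Fin (n + 1))}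
    (hτ : τ ∈ T) {a b : Fin (n + 1)} (ha : a ∈ τ) (hb : b ∈ τ) : Uncrossed T a b := by
  intro σ hσ u hu v hv hau hub
  have h := hT.not_crossing τ hτ σ hσ
  by_contra hc
  rcases lt_or_ge v a with hva | hva
  · exact h (Or.inr ⟨v, hv, a, ha, u, hu, b, hb, hva, hau, hub⟩)
  · exact h (Or.inl ⟨a, ha, u, hu, b, hb, v, hv, hau, hub,
      not_le.1 fun hvb => hc ⟨hva, hvb⟩⟩)

theorem IsTriangulation.mem_of_uncrossed (hT : IsTriangulation n T) {a b c : Fin (n + 1)}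
    (hab : a < b) (hbc : b < c) (h₁ : Uncrossed T a b) (h₂ : Uncrossed T b c)
    (h₃ : Uncrossed T a c) : {a, b, c} ∈ T := by
  refine hT.maximal _ (Finset.card_eq_three.2 ⟨a, b, c, hab.ne, (hab.trans hbc).ne, hbc.ne, rfl⟩)
    fun τ hτ => ?_
  have key : ∀ x ∈ ({a, b, c} : Finset (Fin (n + 1))), ∀ y ∈ ({a, b, c} : Finset (Fin (n + 1))),
      x < y → Uncrossed T x y := by
    intro x hx y hy hxy
    simp only [Finset.mem_insert, Finset.mem_singleton] at hx hy
    rcases hx with rfl | rfl | rfl <;> rcases hy with rfl | rfl | rfl <;>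
      first
        | assumption
        | exact absurd hxy (lt_irrefl _)
        | exact absurd hxy (lt_asymm (by first | assumption | exact hab.trans hbc))
  rintro (⟨x, hx, u, hu, y, hy, v, hv, h, h', h''⟩ | ⟨x, hx, u, hu, y, hy, v, hv, h, h', h''⟩)
  · exact absurd (key u hu v hv (h'.trans h'') τ hτ y hy x hx h' h'').1 (not_le.2 h)
  · exact absurd (key x hx y hy (h.trans h') τ hτ u hu v hv h h').2 (not_le.2 h'')

/-- An uncrossed chord that is not a side of the polygon is the longest side of a triangle. -/
theorem IsTriangulation.exists_mem_of_uncrossed (hT : IsTriangulation n T) {a b m : Fin (n + 1)}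
    (ham : a < m) (hmb : m < b) (h : Uncrossed T a b) :
    ∃ j, a < j ∧ j < b ∧ {a, j, b} ∈ T := by
  classical
  -- The third vertex is the last `j` before `b` joined to `a` by an uncrossed chord.
  let S : Finset (Fin (n + 1)) := Finset.univ.filter fun j => a < j ∧ j < b ∧ Uncrossed T a j
  have hS : S.Nonempty := by
    have hv : a.val + 1 < n + 1 := by
      have := b.isLt
      simp only [Fin.lt_def] at ham hmb
      lia
    refine ⟨⟨a.val + 1, hv⟩, ?_⟩
    simp only [S, Finset.mem_filter, Finset.mem_univ, true_and, Fin.lt_def] at ham hmb ⊢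
    refine ⟨by lia, by lia, fun σ hσ u hu v hv' h₁ h₂ => ?_⟩
    simp only [Fin.lt_def] at h₁ h₂
    lia
  obtain ⟨j, hj, hmax⟩ := S.exists_max_image id hS
  simp only [S, Finset.mem_filter, Finset.mem_univ, true_and, id] at hj hmax
  -- A triangle crossing the chord from `j` to `b` would have `a` as a vertex and a vertex `u`
  -- beyond `j`, so its side from `a` to `u` would contradict the choice of `j`.
  refine ⟨j, hj.1, hj.2.1,
    hT.mem_of_uncrossed hj.1 hj.2.1 hj.2.2 (fun σ hσ u hu v hv h₁ h₂ => ?_) h⟩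
  obtain ⟨h₃, h₄⟩ := h σ hσ u hu v hv (hj.1.trans h₁) h₂
  refine ⟨?_, h₄⟩
  by_contra hvj
  rcases h₃.eq_or_lt with rfl | hav
  · exact absurd (hmax u ⟨hj.1.trans h₁, h₂, hT.uncrossed hσ hv hu⟩) (not_le.2 h₁)
  · exact absurd (hj.2.2 σ hσ v hv u hu hav (not_le.1 hvj)).2 (not_le.2 h₁)

/-- If some triangle does not contain the vertex `0`, then there are two adjacent triangles, only
one of which contains `0`. -/
theorem IsTriangulation.exists_adjacent (hT : IsTriangulation n T) {τ : Finset (Fin (n + 1))}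
    (hτ : τ ∈ T) (h0 : 0 ∉ τ) :
    ∃ i j k : Fin (n + 1), 0 < i ∧ i < j ∧ j < k ∧ {0, i, k} ∈ T ∧ {i, j, k} ∈ T := by
  classical
  obtain ⟨a, b, c, ha, hb, hc, hab, hbc⟩ : ∃ a b c, a ∈ τ ∧ b ∈ τ ∧ c ∈ τ ∧ a < b ∧ b < c := by
    let e := τ.orderEmbOfFin (hT.card_eq_three τ hτ)
    exact ⟨e 0, e 1, e 2, Finset.orderEmbOfFin_mem _ _ _, Finset.orderEmbOfFin_mem _ _ _,
      Finset.orderEmbOfFin_mem _ _ _, e.strictMono (by decide), e.strictMono (by decide)⟩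
  -- The chords from `0` to `i ≤ a` and to `k ≥ c` are the uncrossed ones closest to the triangle.
  have ha0 : 0 < a := Fin.pos_of_ne_zero fun h => h0 (h ▸ ha)
  let S : Finset (Fin (n + 1)) := Finset.univ.filter fun i => 0 < i ∧ i ≤ a ∧ Uncrossed T 0 i
  have hS : S.Nonempty := by
    have hv : 1 < n + 1 := by
      have := a.isLt
      simp only [Fin.lt_def, Fin.val_zero] at ha0
      lia
    refine ⟨⟨1, hv⟩, ?_⟩
    simp only [S, Finset.mem_filter, Finset.mem_univ, true_and, Fin.lt_def, Fin.le_def,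
      Fin.val_zero] at ha0 ⊢
    refine ⟨by lia, by lia, fun σ hσ u hu v hv' h₁ h₂ => ?_⟩
    simp only [Fin.lt_def, Fin.val_zero] at h₁ h₂
    lia
  obtain ⟨i, hi, hmax⟩ := S.exists_max_image id hS
  let S' : Finset (Fin (n + 1)) := Finset.univ.filter fun k => c ≤ k ∧ Uncrossed T 0 k
  have hS' : S'.Nonempty := by
    refine ⟨Fin.last n, ?_⟩
    simp only [S', Finset.mem_filter, Finset.mem_univ, true_and]
    exact ⟨Fin.le_last _, fun σ hσ u hu v hv h₁ h₂ => ⟨Fin.zero_le _, Fin.le_last _⟩⟩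
  obtain ⟨k, hk, hmin⟩ := S'.exists_min_image id hS'
  simp only [S, S', Finset.mem_filter, Finset.mem_univ, true_and, id] at hi hk hmax hmin
  have hib : i < b := hi.2.1.trans_lt hab
  have hbk : b < k := hbc.trans_le hk.1
  have hik : Uncrossed T i k := by
    intro σ hσ u hu v hv h₁ h₂
    have hvk := (hk.2 σ hσ u hu v hv (hi.1.trans h₁) h₂).2
    refine ⟨?_, hvk⟩
    by_contra hvi
    rcases (Fin.zero_le v).eq_or_lt with rfl | hv0
    · have hu' := hT.uncrossed hσ hv hu
      rcases le_or_gt u a with hua | hua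
      · exact absurd (hmax u ⟨hi.1.trans h₁, hua, hu'⟩) (not_le.2 h₁)
      · rcases le_or_gt c u with hcu | hcu
        · exact absurd (hmin u ⟨hcu, hu'⟩) (not_le.2 h₂)
        · exact absurd (hu' τ hτ a ha c hc ha0 hua).2 (not_le.2 hcu)
    · exact absurd (hi.2.2 σ hσ v hv u hu hv0 (not_le.1 hvi)).2 (not_le.2 h₁)
  obtain ⟨j, hij, hjk, hj⟩ := hT.exists_mem_of_uncrossed hib hbk hik
  exact ⟨i, j, k, hi.1, hij, hjk, hT.mem_of_uncrossed hi.1 (hij.trans hjk) hi.2.2 hik hk.2, hj⟩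

end Triangulations

/-! ### The 2-Segal maps -/

/-- Two objects of the `S`-construction over a linear order with at most one pair `x < y` are
isomorphic if their values at this pair are. -/
theorem IsSObject.nonempty_iso {C : Type*} [Category C] {cof : MorphismProperty C} {J : Type}
    [LinearOrder J] {A A' : Ar J ⥤ C} (hA : IsSObject cof J A) (hA' : IsSObject cof J A')
    (hJ : ∀ {x y x' y' : J}, x < y → x' < y' → x = x' ∧ y = y')
    (e : ∀ {x y : J} (h : x < y), Nonempty (A.obj (Ar.mk h.le) ≅ A'.obj (Ar.mk h.le))) :
    Nonempty (A ≅ A') := by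
  have h : ∀ p : Ar J, Nonempty (A.obj p ≅ A'.obj p) := by
    rintro ⟨⟨x, y⟩, hxy⟩
    rcases hxy.eq_or_lt with h | h
    · obtain rfl : x = y := h
      exact ⟨(hA.isZero x).iso (hA'.isZero x)⟩
    · exact e h
  refine ⟨NatIso.ofComponents (fun p => (h p).some) ?_⟩
  rintro ⟨⟨x, y⟩, hxy⟩ ⟨⟨x', y'⟩, hxy'⟩ f
  rcases hxy.eq_or_lt with h₁ | h₁
  · obtain rfl : x = y := h₁
    exact (hA.isZero x).eq_of_src _ _
  · rcases hxy'.eq_or_lt with h₂ | h₂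
    · obtain rfl : x' = y' := h₂
      exact (hA'.isZero x').eq_of_tgt _ _
    · obtain ⟨rfl, rfl⟩ := hJ h₁ h₂
      obtain rfl : f = 𝟙 _ := Subsingleton.elim _ _
      simp

namespace SmashCoalg

/-- The coalgebra with elements `none`, `some false`, `some true`, in which `some t` is sent to the
pair of `some (!t)` and `none`. -/
abbrev linkedPair : SmashCoalg where
  carrier := Option Bool
  op b := b.map fun t => (some (!t), none)

/-- The coalgebra with two elements and trivial operation: the quotient of `linkedPair` by
the element `none`. -/
abbrev freePair : SmashCoalg where
  carrier := Bool
  op _ := none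

section

variable {I : Type} [LinearOrder I]

/-- The filtration of `linkedPair` by the subobject `{none}`. -/
def linkedLevel (i k : I) : linkedPair.carrier → I := fun b => b.elim i fun _ => k

/-- The filtration of `freePair` by the subobject `{false}`. -/
def freeLevel (j k : I) : freePair.carrier → I := fun t => cond t k j

theorem isFiltration_linkedLevel {i k : I} (hik : i ≤ k) : IsFiltration (linkedLevel i k) := by
  rintro (_ | t) p hp
  · simp at hp
  · obtain rfl : (some (!t), none) = p := by simpa using hp
    exact ⟨le_rfl, hik⟩

theorem isFiltration_freeLevel (j k : I) : IsFiltration (freeLevel j k) := by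
  intro t p hp
  simp at hp

/-- The object of the `S`-construction given by the filtered coalgebra `linkedPair`. -/
noncomputable def linkedObject {i k : I} (hik : i < k) : Ar I ⥤ SmashCoalg :=
  layers (isFiltration_linkedLevel hik.le)

/-- The object of the `S`-construction given by the filtered coalgebra `freePair`. -/
noncomputable def freeObject (j k : I) : Ar I ⥤ SmashCoalg :=
  layers (isFiltration_freeLevel j k)

theorem toLayer_linkedLevel_none (i k : I) :
    toLayer (linkedLevel i k) i k (none : linkedPair.carrier) = none :=
  toLayer_of_notMem _ fun h => lt_irrefl _ h.1

theorem isLinked_linkedObject {h i k : I} (hi : h < i) (hik : i < k) :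
    IsLinked ((linkedObject hik).map (homOfLE (show Ar.mk (hi.trans hik).le ≤
      Ar.mk hik.le from ⟨hi.le, le_rfl⟩))) := by
  rintro ⟨_ | t, ht⟩ ⟨c, hc⟩ hbc
  · exact absurd ((toLayer_linkedLevel_none i k).symm.trans hbc) (by simp)
  · have hmem : ∀ s : Bool, i < linkedLevel i k (some s) ∧ linkedLevel i k (some s) ≤ k :=
      fun s => ⟨hik, le_rfl⟩
    have hc' : toLayer (linkedLevel i k) i k (some t) = some ⟨c, hc⟩ := hbc
    rw [toLayer_of_mem _ (hmem t)] at hc'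
    obtain rfl : some t = c := congrArg Subtype.val (Option.some_injective _ hc')
    refine ⟨⟨some (!t), hi.trans hik, le_rfl⟩, ⟨none, hi, hik.le⟩, ⟨some (!t), hmem _⟩, ?_,
      toLayer_of_mem _ (hmem (!t)), ?_⟩
    · exact smash_eq_some.2
        ⟨toLayer_of_mem (linkedLevel i k) (b := some (!t)) ⟨hi.trans hik, le_rfl⟩,
        toLayer_of_mem (linkedLevel i k) (b := none) ⟨hi, hik.le⟩⟩
    · intro h
      have := congrArg Subtype.val h
      simp at this

/-- The operation of `linkedPair` becomes trivial in the quotient by `{none}`. -/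
theorem nonempty_iso_linkedObject_freeObject {i j k : I} (hij : i < j) (hjk : j < k) :
    Nonempty ((linkedObject (hij.trans hjk)).obj (Ar.mk (hij.trans hjk).le) ≅
      (freeObject j k).obj (Ar.mk (hij.trans hjk).le)) := by
  have hik := hij.trans hjk
  have hmem : ∀ t, i < freeLevel j k t ∧ freeLevel j k t ≤ k := by
    rintro (_ | _)
    · exact ⟨hij, hjk.le⟩
    · exact ⟨hik, le_rfl⟩
  have hnone : ∀ b : linkedPair.carrier, i < linkedLevel i k b ∧ linkedLevel i k b ≤ k →
      ∃ t, b = some t := by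
    rintro (_ | t) h
    · exact absurd h.1 (lt_irrefl _)
    · exact ⟨t, rfl⟩
  let e : (layer (freeLevel j k) i k).carrier ≃ (layer (linkedLevel i k) i k).carrier :=
    Equiv.ofBijective (fun t => ⟨some t.1, hik, le_rfl⟩)
      ⟨fun t t' h => Subtype.ext (Option.some_injective _ (congrArg Subtype.val h)), by
        rintro ⟨b, hb⟩
        obtain ⟨t, rfl⟩ := hnone b hb
        exact ⟨⟨t, hmem t⟩, rfl⟩⟩
  refine ⟨(isoOfEquiv e fun t => ?_).symm⟩
  change (some ((some (!t.1) : linkedPair.carrier), (none : linkedPair.carrier))).bind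
    (smash (toLayer (linkedLevel i k) i k)) = none
  rw [Option.bind_some, Option.eq_none_iff_forall_ne_some]
  intro q hq
  exact absurd ((toLayer_linkedLevel_none i k).symm.trans (smash_eq_some.1 hq).2) (by simp)

theorem subsingleton_freeObject {i j k : I} (hij : i < j) (hjk : j < k) :
    Subsingleton ((freeObject j k).obj (Ar.mk hij.le)).carrier := by
  have h : ∀ t : freePair.carrier, freeLevel j k t ≤ j → t = false := by
    rintro (_ | _) ht
    · rfl
    · exact absurd ht (not_le.2 hjk)
  refine ⟨fun a b => Subtype.ext ?_⟩
  exact (h _ a.2.2).trans (h _ b.2.2).symm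

theorem nonempty_freeObject {i j k : I} (hij : i < j) :
    Nonempty ((freeObject j k).obj (Ar.mk hij.le)).carrier :=
  ⟨⟨false, hij, le_rfl⟩⟩

end

open FinBasedCW subcategory

/-- The object of the `S`-construction of `subcategory` corresponding to one for coalgebras. -/
noncomputable def subcategory.sObject {I : Type} [LinearOrder I] {A : Ar I ⥤ SmashCoalg}
    (hA : IsSObject injective I A) : SCat (subcategory.cofibrations cellularInclusion) I :=
  ⟨A ⋙ toCoalg.inv, hA.comp isExact_toCoalg_inv⟩

theorem subcategory.nonempty_iso_of_restrict_eq {I J : Type} [LinearOrder I] [LinearOrder J]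
    {A : Ar I ⥤ SmashCoalg} (hA : IsSObject injective I A) (f : J ↪o I)
    (X : SCat (subcategory.cofibrations cellularInclusion) I)
    (h : IsoS.restrict (subcategory.cofibrations cellularInclusion) f ⟦X⟧ =
      IsoS.restrict _ f ⟦sObject hA⟧) :
    Nonempty (Ar.map f ⋙ A ≅ Ar.map f ⋙ X.obj ⋙ toCoalg) := by
  obtain ⟨e⟩ := Quotient.exact h
  have e' : Ar.map f ⋙ X.obj ≅ Ar.map f ⋙ A ⋙ toCoalg.inv := (ObjectProperty.ι _).mapIso e
  have e'' : (Ar.map f ⋙ A) ⋙ toCoalg.inv ⋙ toCoalg ≅ (Ar.map f ⋙ A) ⋙ 𝟭 _ :=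
    Functor.isoWhiskerLeft _ toCoalg.asEquivalence.counitIso
  exact ⟨e''.symm ≪≫ (Functor.isoWhiskerRight e' toCoalg).symm⟩

/-- Consider a subdivision of the polygon along the chord from `i` to `k`, with a member containing
`h < i` and the chord, and a member containing the chord and some `j` between `i` and `k`. The
2-Segal map is not surjective: glue the filtration of `linkedPair`, on the side of `h`, to that of
`freePair`, on the side of `j`. -/
theorem subcategory.not_surjective_segalMap {n : ℕ} {T : Finset (Finset (Fin (n + 1)))}
    {p q : Finset (Fin (n + 1))} (hp : p ∈ T) (hq : q ∈ T) {h i j k : Fin (n + 1)} (hi : h < i)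
    (hij : i < j) (hjk : j < k) (hhp : h ∈ p) (hip : i ∈ p) (hkp : k ∈ p) (hiq : i ∈ q)
    (hjq : j ∈ q) (hkq : k ∈ q)
    (hT : ∀ r ∈ T, (∀ x ∈ r, i ≤ x ∧ x ≤ k) ∨ ∀ x ∈ r, x ≤ i ∨ k ≤ x) :
    ¬ Function.Surjective
      (segalMap (n := n) (subcategory.cofibrations cellularInclusion) T) := by
  classical
  intro hsurj
  have hik := hij.trans hjk
  have hL : IsSObject injective (Fin (n + 1)) (linkedObject hik) := isSObject_layers _
  have hF : IsSObject injective (Fin (n + 1)) (freeObject j k) := isSObject_layers _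
  let Z : Finset (Fin (n + 1)) → SCat (subcategory.cofibrations cellularInclusion) (Fin (n + 1)) :=
    fun r => if ∀ x ∈ r, i ≤ x ∧ x ≤ k then sObject hF else sObject hL
  -- A member inside the interval from `i` to `k` and one outside
  -- have at most `i` and `k` in common.
  have hedge : ∀ r s : Finset (Fin (n + 1)), (∀ x ∈ r, i ≤ x ∧ x ≤ k) →
      (∀ x ∈ s, x ≤ i ∨ k ≤ x) →
      IsoS.restrict (subcategory.cofibrations cellularInclusion)
          (OrderEmbedding.subtype (· ∈ r ∩ s)) ⟦sObject hL⟧ =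
        IsoS.restrict _ (OrderEmbedding.subtype (· ∈ r ∩ s)) ⟦sObject hF⟧ := by
    intro r s hr hs
    have hend : ∀ {x y : {v // v ∈ r ∩ s}}, x < y → x.1 = i ∧ y.1 = k := by
      rintro ⟨x, hx⟩ ⟨y, hy⟩ hxy
      have hxy' : x < y := hxy
      obtain ⟨hx₁, hx₂⟩ := hr x (Finset.mem_inter.1 hx).1
      obtain ⟨hy₁, hy₂⟩ := hr y (Finset.mem_inter.1 hy).1
      have hx₃ := (hs x (Finset.mem_inter.1 hx).2).resolve_right
        fun h' => absurd (h'.trans_lt hxy') (not_lt.2 hy₂)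
      have hy₃ := (hs y (Finset.mem_inter.1 hy).2).resolve_left
        fun h' => absurd (hxy'.trans_le h') (not_lt.2 hx₁)
      exact ⟨le_antisymm hx₃ hx₁, le_antisymm hy₂ hy₃⟩
    obtain ⟨e⟩ := IsSObject.nonempty_iso
      (SCat.restrict _ (OrderEmbedding.subtype (· ∈ r ∩ s)) |>.obj (sObject hL)).property
      (SCat.restrict _ (OrderEmbedding.subtype (· ∈ r ∩ s)) |>.obj (sObject hF)).property
      (fun h₁ h₂ => ⟨Subtype.ext ((hend h₁).1.trans (hend h₂).1.symm),
        Subtype.ext ((hend h₁).2.trans (hend h₂).2.symm)⟩)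
      (by
        rintro ⟨x, hx⟩ ⟨y, hy⟩ hxy
        obtain ⟨rfl, rfl⟩ := hend hxy
        obtain ⟨e⟩ := nonempty_iso_linkedObject_freeObject hij hjk
        exact ⟨toCoalg.inv.mapIso e⟩)
    exact Quotient.sound ⟨(ObjectProperty.fullyFaithfulι _).preimageIso e⟩
  have hZ : ∀ r s : Finset (Fin (n + 1)), r ∈ T → s ∈ T →
      IsoS.restrict (subcategory.cofibrations cellularInclusion)
          (OrderEmbedding.subtype (· ∈ r ∩ s)) ⟦Z r⟧ =
        IsoS.restrict _ (OrderEmbedding.subtype (· ∈ r ∩ s)) ⟦Z s⟧ := by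
    intro r s hr hs
    by_cases h₁ : ∀ x ∈ r, i ≤ x ∧ x ≤ k <;> by_cases h₂ : ∀ x ∈ s, i ≤ x ∧ x ≤ k
    · simp only [Z, if_pos h₁, if_pos h₂]
    · simp only [Z, if_pos h₁, if_neg h₂]
      exact (hedge r s h₁ ((hT s hs).resolve_left h₂)).symm
    · simp only [Z, if_neg h₁, if_pos h₂]
      have := hedge s r h₂ ((hT r hr).resolve_left h₁)
      rwa [Finset.inter_comm] at this
    · simp only [Z, if_neg h₁, if_neg h₂]
  obtain ⟨x, hx⟩ := hsurj ⟨fun r => IsoS.restrict _ (OrderEmbedding.subtype (· ∈ r.1)) ⟦Z r.1⟧,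
    fun r s _ => by
      rw [IsoS.restrict_restrict _ _ _ (OrderEmbedding.subtype (· ∈ r.1 ∩ s.1)) (fun _ => rfl),
        IsoS.restrict_restrict _ _ _ (OrderEmbedding.subtype (· ∈ r.1 ∩ s.1)) (fun _ => rfl)]
      exact hZ _ _ r.2 s.2⟩
  induction x using Quotient.inductionOn with
  | h X =>
    have hr : ∀ r (hr : r ∈ T), IsoS.restrict _ (OrderEmbedding.subtype (· ∈ r)) ⟦X⟧ =
        IsoS.restrict _ (OrderEmbedding.subtype (· ∈ r)) ⟦Z r⟧ :=
      fun r hr => congrFun (congrArg Subtype.val hx) ⟨r, hr⟩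
    have hZp : Z p = sObject hL := if_neg fun h' => absurd (h' h hhp).1 (not_le.2 hi)
    have hZq : Z q = sObject hF := if_pos <| (hT q hq).resolve_right fun h' =>
      (h' j hjq).elim (not_le.2 hij) (not_le.2 hjk)
    have h₁ := hr p hp
    have h₂ := hr q hq
    rw [hZp] at h₁
    rw [hZq] at h₂
    obtain ⟨e₁⟩ := nonempty_iso_of_restrict_eq hL _ X h₁
    obtain ⟨e₂⟩ := nonempty_iso_of_restrict_eq hF _ X h₂
    have hlink := (isLinked_linkedObject hi hik).of_iso
      (e₁.app (Ar.mk (show (⟨h, hhp⟩ : {v // v ∈ p}) ≤ ⟨k, hkp⟩ from (hi.trans hik).le)))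
      (e₁.app (Ar.mk (show (⟨i, hip⟩ : {v // v ∈ p}) ≤ ⟨k, hkp⟩ from hik.le)))
      (e₁.hom.naturality
        (X := Ar.mk (show (⟨h, hhp⟩ : {v // v ∈ p}) ≤ ⟨k, hkp⟩ from (hi.trans hik).le))
        (Y := Ar.mk (show (⟨i, hip⟩ : {v // v ∈ p}) ≤ ⟨k, hkp⟩ from hik.le))
        (homOfLE ⟨hi.le, le_rfl⟩))
    let e₃ := e₂.app (Ar.mk (show (⟨i, hiq⟩ : {v // v ∈ q}) ≤ ⟨j, hjq⟩ from hij.le))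
    obtain ⟨m, -, -⟩ := injective_of_isIso e₃.hom
    obtain ⟨m', hm', -⟩ := injective_of_isIso e₃.inv
    obtain ⟨c⟩ := nonempty_freeObject (k := k) hij
    have hs := subsingleton_freeObject hij hjk
    exact false_of_isLinked (X.property.comp isExact_toCoalg) hi hij hjk hlink
      ⟨fun a b => hm' (hs.elim _ _)⟩ (m c)

end SmashCoalg

end TwoSegal

open TwoSegal in
theorem proposition6p5 :
    ∃ (D₀ D : Subcategory FinBasedCW),
      D₀.ContainsZero ∧
      D = D₀.generated FinBasedCW.cellularInclusion ∧
      D.IsSubcategoryWithCofibrations FinBasedCW.cellularInclusion ∧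
      (∀ n : ℕ, 3 ≤ n →
        ¬ Function.Surjective
          (segalMap (n := n) (D.cofibrations FinBasedCW.cellularInclusion)
            {{0, 1, Fin.last n}, Finset.univ.erase 0})) ∧
      (∀ (n : ℕ) (T : Finset (Finset (Fin (n + 1)))), IsTriangulation n T →
        (∃ τ ∈ T, 0 ∉ τ) →
        ¬ Function.Surjective
          (segalMap (D.cofibrations FinBasedCW.cellularInclusion) T)) := by
  refine ⟨SmashCoalg.subcategory, SmashCoalg.subcategory, SmashCoalg.subcategory.containsZero,
    (Subcategory.generated_eq_self SmashCoalg.subcategory.isSubcategoryWithCofibrations).symm,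
    SmashCoalg.subcategory.isSubcategoryWithCofibrations, fun n hn => ?_, fun n T hT hτ => ?_⟩
  · obtain ⟨m, rfl⟩ : ∃ m, n = m + 3 := ⟨n - 3, by lia⟩
    have h1 : ((1 : Fin (m + 3 + 1)) : ℕ) = 1 := rfl
    refine SmashCoalg.subcategory.not_surjective_segalMap
      (p := {0, 1, Fin.last (m + 3)}) (q := Finset.univ.erase 0)
      (h := 0) (i := 1) (j := ⟨2, by lia⟩) (k := Fin.last (m + 3)) (by simp) (by simp)
      (by simp) (Fin.lt_def.2 (by rw [h1]; exact Nat.lt_succ_self 1))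
      (Fin.lt_def.2 (by rw [Fin.val_last]; exact Nat.le_add_left 3 m)) (by simp) (by simp)
      (by simp) (by simp) (by simp [Fin.ext_iff]) (by simp [Fin.ext_iff]) fun r hr => ?_
    rw [Finset.mem_insert, Finset.mem_singleton] at hr
    rcases hr with rfl | rfl
    · right
      intro x hx
      simp only [Finset.mem_insert, Finset.mem_singleton] at hx
      rcases hx with rfl | rfl | rfl
      · exact Or.inl (Fin.zero_le _)
      · exact Or.inl le_rfl
      · exact Or.inr le_rfl
    · left
      intro x hx
      exact ⟨Fin.one_le_of_ne_zero (Finset.ne_of_mem_erase hx), Fin.le_last _⟩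
  · obtain ⟨τ, hτ, h0⟩ := hτ
    obtain ⟨i, j, k, hi, hij, hjk, hp, hq⟩ := hT.exists_adjacent hτ h0
    refine SmashCoalg.subcategory.not_surjective_segalMap hp hq hi hij hjk (by simp) (by simp)
      (by simp) (by simp) (by simp) (by simp) fun r hr => ?_
    -- The chord from `i` to `k` is a side of a triangle of `T`, so it is uncrossed.
    by_contra hc
    push Not at hc
    obtain ⟨⟨x, hx, hx'⟩, y, hy, hiy, hyk⟩ := hc
    obtain ⟨h₁, h₂⟩ := hT.uncrossed hq (a := i) (b := k) (by simp) (by simp) r hr y hy x hx hiy hyk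
    exact absurd h₂ (not_le.2 (hx' h₁))
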